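/- Let $q\in\mathbb C$ be nonzero and not a root of unity. Write $[x,y]=xy-yx$, $[x,y]_q=qxy-q^{-1}yx$ and $[k]_q=\frac{q^k-q^{-k}}{q-q^{-1}}$ for $k\in\mathbb Z$; algebras are unital associative over $\mathbb C$, and $\otimes=\otimes_{\mathbb C}$. Let $U_q(\mathfrak{sl}_2)$ be the algebra with generators $E,F,K^{\pm1}$ and relations $KK^{-1}=K^{-1}K=1$, $[E,K]_q=[K,F]_q=0$, $[E,F]=\frac{K-K^{-1}}{q-q^{-1}}$. For $n\in\mathbb N=\{0,1,2,\dots\}$ let $L_n$ be the $(n+1)$-dimensional $U_q(\mathfrak{sl}_2)$-module with basis $v_0,\dots,v_n$ and action $Ev_0=0$, $Ev_i=[i]_q[n-i+1]_q\,v_{i-1}$ $(1\le i\le n)$, $Fv_i=v_{i+1}$ $(0\le i\le n-1)$, $Fv_n=0$, $Kv_i=q^{n-2i}v_i$ $(0\le i\le n)$. Let $\mathfrak W_q$ be the algebra with generators $E_1,E_2,F_1,F_2,K_1^{\pm1},K_2^{\pm1},I^{\pm1}$ and the following relations: $I$ is central; $II^{-1}=I^{-1}I=1$; $K_iK_i^{-1}=K_i^{-1}K_i=1$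 for $i=1,2$; $$[K_1,E_2]=[K_1,F_2]=[K_1,K_2]=[K_2,E_1]=[K_2,F_1]=0,$$ $$[E_1,K_1]_q=[K_1,F_1]_q=[E_2,K_2]_q=[K_2,F_2]_q=0,$$ $$[E_1,E_2]=[E_1,F_2]=[F_1,E_2]=[F_1,F_2]=0,$$ $$[E_1,F_1]=\frac{K_1-IK_1^{-1}}{q-q^{-1}},\qquad [E_2,F_2]=\frac{IK_2-K_2^{-1}}{q-q^{-1}}.$$ Regard the $U_q(\mathfrak{sl}_2)\otimes U_q(\mathfrak{sl}_2)$-module $L_m\otimes L_n$ as a $\mathfrak W_q$-module by pulling back along the algebra homomorphism $\flat:\mathfrak W_q\to U_q(\mathfrak{sl}_2)\otimes U_q(\mathfrak{sl}_2)$ with $E_1\mapsto E\otimes1$, $E_2\mapsto1\otimes E$, $F_1\mapsto F\otimes1$, $F_2\mapsto1\otimes F$, $K_1^{\pm1}\mapsto K^{\pm1}\otimes1$, $K_2^{\pm1}\mapsto1\otimes K^{\pm1}$, $I^{\pm1}\mapsto1\otimes1$. For $\delta\in\{1,-1\}$ and $\lambda\in\mathbb C\setminus\{0\}$ let $\sigma_{\delta,\lambda}:\mathfrak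 W_q\to\mathfrak W_q$ be the algebra homomorphism with $E_1\mapsto\lambda E_1$, $E_2\mapsto\delta\lambda E_2$, $F_1\mapsto F_1$, $F_2\mapsto F_2$, $K_1^{\pm1}\mapsto\lambda^{\pm1}K_1^{\pm1}$, $K_2^{\pm1}\mapsto\delta\lambda^{\mp1}K_2^{\pm1}$, $I^{\pm1}\mapsto\lambda^{\pm2}I^{\pm1}$. Let $(L_m\otimes L_n)^{\delta,\lambda}$ be the vector space $L_m\otimes L_n$ on which $x\in\mathfrak W_q$ acts as $\sigma_{\delta,\lambda}(x)$ acts on the $\mathfrak W_q$-module $L_m\otimes L_n$. **Theorem.** For every finite-dimensional irreducible $\mathfrak W_q$-module $V$ there is a unique quadruple $(m,n,\delta,\lambda)$ with $m,n\in\mathbb N$, $\delta\in\{1,-1\}$ and $\lambda\in\mathbb C\setminus\{0\}$ such that $V$ is isomorphic to $(L_m\otimes L_n)^{\delta,\lambda}$ as a $\mathfrak W_q$-module. Moreover, every $(L_m\otimes L_n)^{\delta,\lambda}$ is a finite-dimensional irreducible $\mathfrak W_q$-module, and the map sending $(m,n,\delta,\lambda)$ to the isomorphism class of $(L_m\otimes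 L_n)^{\delta,\lambda}$ is a bijection from the set of these quadruples onto the set of isomorphism classes of finite-dimensional irreducible $\mathfrak W_q$-modules. -/

import Mathlib

open scoped TensorProduct

universe u

noncomputable section

namespace QuantumCovering

/-- The `q`-analogue `[k]_q = (q^k - q^{-k}) / (q - q^{-1})` of an integer `k`. -/
def qInt (q : ℂ) (k : ℤ) : ℂ := (q ^ k - q ^ (-k)) / (q - q⁻¹)

/-- The `q`-bracket `[x, y]_q = q x y - q^{-1} y x`. The ordinary commutator `x y - y x` is
Mathlib's ring commutator `⁅x, y⁆`. -/
def qBracket {A : Type*} [Ring A] [Algebra ℂ A] (q : ℂ) (x y : A) : A :=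
  q • (x * y) - q⁻¹ • (y * x)

/-! ### The quantum algebra of `sl₂` -/

/-- Generators of the quantum algebra of `sl₂`; `Ki` stands for `K^{-1}`. -/
inductive UGen
  | E | F | K | Ki

/-- Defining relations of the quantum algebra of `sl₂`. -/
inductive URel (q : ℂ) : FreeAlgebra ℂ UGen → FreeAlgebra ℂ UGen → Prop
  | K_Ki : URel q (FreeAlgebra.ι ℂ UGen.K * FreeAlgebra.ι ℂ UGen.Ki) 1
  | Ki_K : URel q (FreeAlgebra.ι ℂ UGen.Ki * FreeAlgebra.ι ℂ UGen.K) 1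
  | E_K : URel q (qBracket q (FreeAlgebra.ι ℂ UGen.E) (FreeAlgebra.ι ℂ UGen.K)) 0
  | K_F : URel q (qBracket q (FreeAlgebra.ι ℂ UGen.K) (FreeAlgebra.ι ℂ UGen.F)) 0
  | E_F : URel q ⁅FreeAlgebra.ι ℂ UGen.E, FreeAlgebra.ι ℂ UGen.F⁆
      ((q - q⁻¹)⁻¹ • (FreeAlgebra.ι ℂ UGen.K - FreeAlgebra.ι ℂ UGen.Ki))

/-- The quantum algebra `U_q(sl₂)` over `ℂ`, by generators and relations. -/
def Uq (q : ℂ) : Type := RingQuot (URel q)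

instance (q : ℂ) : Ring (Uq q) := inferInstanceAs (Ring (RingQuot (URel q)))

instance (q : ℂ) : Algebra ℂ (Uq q) := inferInstanceAs (Algebra ℂ (RingQuot (URel q)))

/-- The quotient map from the free algebra. -/
def Uq.mk (q : ℂ) : FreeAlgebra ℂ UGen →ₐ[ℂ] Uq q := RingQuot.mkAlgHom ℂ (URel q)

/-- The image of a generator. -/
def Uq.gen (q : ℂ) (x : UGen) : Uq q := Uq.mk q (FreeAlgebra.ι ℂ x)

theorem Uq.mk_rel (q : ℂ) {a b : FreeAlgebra ℂ UGen} (h : URel q a b) :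
    Uq.mk q a = Uq.mk q b :=
  RingQuot.mkAlgHom_rel ℂ h

theorem Uq.mk_surjective (q : ℂ) : Function.Surjective (Uq.mk q) :=
  RingQuot.mkAlgHom_surjective ℂ (URel q)

/-- The algebra homomorphism out of the presented algebra determined by images of the generators
that satisfy the defining relations. -/
def Uq.lift {q : ℂ} {A : Type*} [Semiring A] [Algebra ℂ A] (f : UGen → A)
    (hf : ∀ ⦃a b : FreeAlgebra ℂ UGen⦄, URel q a b →
      FreeAlgebra.lift ℂ f a = FreeAlgebra.lift ℂ f b) : Uq q →ₐ[ℂ] A :=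
  RingQuot.liftAlgHom ℂ ⟨FreeAlgebra.lift ℂ f, hf⟩

theorem Uq.lift_gen {q : ℂ} {A : Type*} [Semiring A] [Algebra ℂ A] (f : UGen → A)
    (hf : ∀ ⦃a b : FreeAlgebra ℂ UGen⦄, URel q a b →
      FreeAlgebra.lift ℂ f a = FreeAlgebra.lift ℂ f b) (x : UGen) :
    Uq.lift f hf (Uq.gen q x) = f x :=
  (RingQuot.liftAlgHom_mkAlgHom_apply ℂ (FreeAlgebra.lift ℂ f) hf _).trans
    (FreeAlgebra.lift_ι_apply f x)

/-! ### The algebra `W_q` -/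

/-- Generators of `W_q`; `K1i`, `K2i`, `Ii` stand for `K₁^{-1}`, `K₂^{-1}`, `I^{-1}`. -/
inductive WGen
  | E1 | E2 | F1 | F2 | K1 | K1i | K2 | K2i | I | Ii

/-- The free generator of the free algebra on the generators of `W_q`. -/
abbrev wι (x : WGen) : FreeAlgebra ℂ WGen := FreeAlgebra.ι ℂ x

/-- Defining relations of `W_q`. -/
inductive WRel (q : ℂ) : FreeAlgebra ℂ WGen → FreeAlgebra ℂ WGen → Prop
  | I_central (a : FreeAlgebra ℂ WGen) : WRel q (wι .I * a) (a * wι .I)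
  | I_Ii : WRel q (wι .I * wι .Ii) 1
  | Ii_I : WRel q (wι .Ii * wι .I) 1
  | K1_K1i : WRel q (wι .K1 * wι .K1i) 1
  | K1i_K1 : WRel q (wι .K1i * wι .K1) 1
  | K2_K2i : WRel q (wι .K2 * wι .K2i) 1
  | K2i_K2 : WRel q (wι .K2i * wι .K2) 1
  | K1_E2 : WRel q ⁅wι .K1, wι .E2⁆ 0
  | K1_F2 : WRel q ⁅wι .K1, wι .F2⁆ 0
  | K1_K2 : WRel q ⁅wι .K1, wι .K2⁆ 0
  | K2_E1 : WRel q ⁅wι .K2, wι .E1⁆ 0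
  | K2_F1 : WRel q ⁅wι .K2, wι .F1⁆ 0
  | E1_K1 : WRel q (qBracket q (wι .E1) (wι .K1)) 0
  | K1_F1 : WRel q (qBracket q (wι .K1) (wι .F1)) 0
  | E2_K2 : WRel q (qBracket q (wι .E2) (wι .K2)) 0
  | K2_F2 : WRel q (qBracket q (wι .K2) (wι .F2)) 0
  | E1_E2 : WRel q ⁅wι .E1, wι .E2⁆ 0
  | E1_F2 : WRel q ⁅wι .E1, wι .F2⁆ 0
  | F1_E2 : WRel q ⁅wι .F1, wι .E2⁆ 0
  | F1_F2 : WRel q ⁅wι .F1, wι .F2⁆ 0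
  | E1_F1 : WRel q ⁅wι .E1, wι .F1⁆ ((q - q⁻¹)⁻¹ • (wι .K1 - wι .I * wι .K1i))
  | E2_F2 : WRel q ⁅wι .E2, wι .F2⁆ ((q - q⁻¹)⁻¹ • (wι .I * wι .K2 - wι .K2i))

/-- The algebra `W_q` over `ℂ`, by generators and relations. -/
def Wq (q : ℂ) : Type := RingQuot (WRel q)

instance (q : ℂ) : Ring (Wq q) := inferInstanceAs (Ring (RingQuot (WRel q)))

instance (q : ℂ) : Algebra ℂ (Wq q) := inferInstanceAs (Algebra ℂ (RingQuot (WRel q)))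

/-- The quotient map from the free algebra. -/
def Wq.mk (q : ℂ) : FreeAlgebra ℂ WGen →ₐ[ℂ] Wq q := RingQuot.mkAlgHom ℂ (WRel q)

/-- The image of a generator. -/
def Wq.gen (q : ℂ) (x : WGen) : Wq q := Wq.mk q (FreeAlgebra.ι ℂ x)

theorem Wq.mk_rel (q : ℂ) {a b : FreeAlgebra ℂ WGen} (h : WRel q a b) :
    Wq.mk q a = Wq.mk q b :=
  RingQuot.mkAlgHom_rel ℂ h

theorem Wq.mk_surjective (q : ℂ) : Function.Surjective (Wq.mk q) :=
  RingQuot.mkAlgHom_surjective ℂ (WRel q)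

/-- The algebra homomorphism out of the presented algebra determined by images of the generators
that satisfy the defining relations. -/
def Wq.lift {q : ℂ} {A : Type*} [Semiring A] [Algebra ℂ A] (f : WGen → A)
    (hf : ∀ ⦃a b : FreeAlgebra ℂ WGen⦄, WRel q a b →
      FreeAlgebra.lift ℂ f a = FreeAlgebra.lift ℂ f b) : Wq q →ₐ[ℂ] A :=
  RingQuot.liftAlgHom ℂ ⟨FreeAlgebra.lift ℂ f, hf⟩

theorem Wq.lift_gen {q : ℂ} {A : Type*} [Semiring A] [Algebra ℂ A] (f : WGen → A)
    (hf : ∀ ⦃a b : FreeAlgebra ℂ WGen⦄, WRel q a b →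
      FreeAlgebra.lift ℂ f a = FreeAlgebra.lift ℂ f b) (x : WGen) :
    Wq.lift f hf (Wq.gen q x) = f x :=
  (RingQuot.liftAlgHom_mkAlgHom_apply ℂ (FreeAlgebra.lift ℂ f) hf _).trans
    (FreeAlgebra.lift_ι_apply f x)

/-! ### The homomorphism `♭ : W_q → U_q(sl₂) ⊗ U_q(sl₂)` -/

/-- The values of `♭` on the generators. -/
def flatFun (q : ℂ) : WGen → Uq q ⊗[ℂ] Uq q
  | .E1 => Uq.gen q .E ⊗ₜ 1
  | .E2 => 1 ⊗ₜ Uq.gen q .E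
  | .F1 => Uq.gen q .F ⊗ₜ 1
  | .F2 => 1 ⊗ₜ Uq.gen q .F
  | .K1 => Uq.gen q .K ⊗ₜ 1
  | .K1i => Uq.gen q .Ki ⊗ₜ 1
  | .K2 => 1 ⊗ₜ Uq.gen q .K
  | .K2i => 1 ⊗ₜ Uq.gen q .Ki
  | .I => 1
  | .Ii => 1

theorem Uq.K_Ki (q : ℂ) : Uq.gen q .K * Uq.gen q .Ki = 1 := by
  simpa [Uq.gen] using Uq.mk_rel q URel.K_Ki

theorem Uq.Ki_K (q : ℂ) : Uq.gen q .Ki * Uq.gen q .K = 1 := by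
  simpa [Uq.gen] using Uq.mk_rel q URel.Ki_K

theorem Uq.E_K (q : ℂ) : qBracket q (Uq.gen q .E) (Uq.gen q .K) = 0 := by
  simpa [Uq.gen, qBracket] using Uq.mk_rel q URel.E_K

theorem Uq.K_F (q : ℂ) : qBracket q (Uq.gen q .K) (Uq.gen q .F) = 0 := by
  simpa [Uq.gen, qBracket] using Uq.mk_rel q URel.K_F

theorem Uq.E_F (q : ℂ) : ⁅Uq.gen q .E, Uq.gen q .F⁆ =
    (q - q⁻¹)⁻¹ • (Uq.gen q .K - Uq.gen q .Ki) := by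
  simpa [Uq.gen, Ring.lie_def] using Uq.mk_rel q URel.E_F

theorem flatFun_rel (q : ℂ) ⦃a b : FreeAlgebra ℂ WGen⦄ (h : WRel q a b) :
    FreeAlgebra.lift ℂ (flatFun q) a = FreeAlgebra.lift ℂ (flatFun q) b := by
  have h1 := Uq.K_Ki q
  have h2 := Uq.Ki_K q
  have h3 := Uq.E_K q
  have h4 := Uq.K_F q
  have h5 := Uq.E_F q
  simp only [qBracket, Ring.lie_def] at h3 h4 h5
  cases h <;> simp [wι, flatFun, qBracket, Ring.lie_def, h1, h2, Algebra.TensorProduct.one_def,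
    ← TensorProduct.smul_tmul', ← TensorProduct.tmul_smul, ← TensorProduct.sub_tmul,
    ← TensorProduct.tmul_sub, h3, h4, h5]
  case I_central a => rw [← Algebra.TensorProduct.one_def, one_mul, mul_one]
  all_goals
    simp only [TensorProduct.tmul_smul, TensorProduct.smul_tmul', ← TensorProduct.sub_tmul, h3, h4,
      TensorProduct.zero_tmul]

/-- The algebra homomorphism `♭ : W_q → U_q(sl₂) ⊗ U_q(sl₂)` with `E₁ ↦ E ⊗ 1`, `E₂ ↦ 1 ⊗ E`,
`F₁ ↦ F ⊗ 1`, `F₂ ↦ 1 ⊗ F`, `K₁^{±1} ↦ K^{±1} ⊗ 1`, `K₂^{±1} ↦ 1 ⊗ K^{±1}`, `I^{±1} ↦ 1 ⊗ 1`. -/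
def flat (q : ℂ) : Wq q →ₐ[ℂ] Uq q ⊗[ℂ] Uq q :=
  Wq.lift (flatFun q) (flatFun_rel q)

/-! ### The index set and the twisting automorphisms `σ_{δ,lam}` -/

/-- Quadruples `(m, n, δ, lam)` with `m, n ∈ ℕ`, `δ ∈ {1, -1}` and `lam` a nonzero complex
number. -/
structure Quad where
  m : ℕ
  n : ℕ
  δ : ℂ
  lam : ℂ
  hδ : δ = 1 ∨ δ = -1
  hlam : lam ≠ 0

/-- The values of `σ_{δ,lam}` on the generators. -/
def sigmaFun (q δ lam : ℂ) : WGen → Wq q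
  | .E1 => lam • Wq.gen q .E1
  | .E2 => (δ * lam) • Wq.gen q .E2
  | .F1 => Wq.gen q .F1
  | .F2 => Wq.gen q .F2
  | .K1 => lam • Wq.gen q .K1
  | .K1i => lam⁻¹ • Wq.gen q .K1i
  | .K2 => (δ * lam⁻¹) • Wq.gen q .K2
  | .K2i => (δ * lam) • Wq.gen q .K2i
  | .I => (lam ^ 2) • Wq.gen q .I
  | .Ii => (lam ^ 2)⁻¹ • Wq.gen q .Ii

theorem sigmaFun_rel (q : ℂ) {δ lam : ℂ} (hδ : δ = 1 ∨ δ = -1) (hlam : lam ≠ 0)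
    ⦃a b : FreeAlgebra ℂ WGen⦄ (h : WRel q a b) :
    FreeAlgebra.lift ℂ (sigmaFun q δ lam) a = FreeAlgebra.lift ℂ (sigmaFun q δ lam) b := by
  have hδ2 : δ * δ = 1 := by rcases hδ with rfl | rfl <;> norm_num
  have unit : ∀ {c d : ℂ} {x y : Wq q}, x * y = 1 → c * d = 1 → (c • x) * (d • y) = 1 := by
    intro c d x y h1 h2
    rw [smul_mul_smul_comm, h1, h2, one_smul]
  have comm : ∀ {c d : ℂ} {x y : Wq q}, x * y - y * x = 0 →
      (c • x) * (d • y) - (d • y) * (c • x) = 0 := by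
    intro c d x y h1
    rw [smul_mul_smul_comm, smul_mul_smul_comm, mul_comm d c, ← smul_sub, h1, smul_zero]
  have qcomm : ∀ {c d : ℂ} {x y : Wq q}, q • (x * y) - q⁻¹ • (y * x) = 0 →
      q • ((c • x) * (d • y)) - q⁻¹ • ((d • y) * (c • x)) = 0 := by
    intro c d x y h1
    rw [smul_mul_smul_comm, smul_mul_smul_comm, mul_comm d c, smul_comm q, smul_comm q⁻¹,
      ← smul_sub, h1, smul_zero]
  have hfg : ∀ x : WGen, FreeAlgebra.lift ℂ (sigmaFun q δ lam) (wι x) = sigmaFun q δ lam x :=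
    fun x => FreeAlgebra.lift_ι_apply _ _
  have hF1 : sigmaFun q δ lam .F1 = (1 : ℂ) • Wq.gen q .F1 := (one_smul _ _).symm
  have hF2 : sigmaFun q δ lam .F2 = (1 : ℂ) • Wq.gen q .F2 := (one_smul _ _).symm
  have hl1 : lam * lam⁻¹ = 1 := mul_inv_cancel₀ hlam
  have hl2 : lam⁻¹ * lam = 1 := inv_mul_cancel₀ hlam
  have e1 : δ * lam⁻¹ * (δ * lam) = 1 := by
    rw [mul_mul_mul_comm, hδ2, hl2, one_mul]
  have e2 : δ * lam * (δ * lam⁻¹) = 1 := by rw [mul_comm, e1]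
  have hg : ∀ x : WGen, Wq.mk q (wι x) = Wq.gen q x := fun _ => rfl
  have h0 := Wq.mk_rel q h
  cases h
  case I_central a =>
    obtain ⟨y, hy⟩ := Wq.mk_surjective q (FreeAlgebra.lift ℂ (sigmaFun q δ lam) a)
    have h1 := Wq.mk_rel q (WRel.I_central y)
    rw [map_mul, map_mul, hy, hg] at h1
    simp only [map_mul, hfg, sigmaFun, smul_mul_assoc, mul_smul_comm, h1]
  all_goals
    simp only [qBracket, Ring.lie_def, map_sub, map_mul, map_smul, map_one, map_zero, hfg, hg,
      hF1, hF2] at h0 ⊢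
  case E1_F1 =>
    have h1 : lam ^ 2 * lam⁻¹ = lam := by rw [pow_two, mul_assoc, hl1, mul_one]
    simp only [sigmaFun, smul_mul_smul_comm, mul_one, one_mul, h1]
    rw [← smul_sub, ← smul_sub, h0, smul_comm]
  case E2_F2 =>
    have h1 : lam ^ 2 * (δ * lam⁻¹) = δ * lam := by
      rw [mul_left_comm, pow_two, mul_assoc lam, hl1, mul_one]
    simp only [sigmaFun, smul_mul_smul_comm, mul_one, one_mul, h1]
    rw [← smul_sub, ← smul_sub, h0, smul_comm]
  all_goals
    first
      | exact comm h0
      | exact qcomm h0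
      | exact unit h0 hl1
      | exact unit h0 hl2
      | exact unit h0 e1
      | exact unit h0 e2
      | exact unit h0 (mul_inv_cancel₀ (pow_ne_zero 2 hlam))
      | exact unit h0 (inv_mul_cancel₀ (pow_ne_zero 2 hlam))

/-- The algebra endomorphism `σ_{δ,lam}` of `W_q` with `E₁ ↦ lam E₁`, `E₂ ↦ δ lam E₂`, `F₁ ↦ F₁`,
`F₂ ↦ F₂`, `K₁^{±1} ↦ lam^{±1} K₁^{±1}`, `K₂^{±1} ↦ δ lam^{∓1} K₂^{±1}`,
`I^{±1} ↦ lam^{±2} I^{±1}`. -/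
def sigma (q : ℂ) {δ lam : ℂ} (hδ : δ = 1 ∨ δ = -1) (hlam : lam ≠ 0) : Wq q →ₐ[ℂ] Wq q :=
  Wq.lift (sigmaFun q δ lam) (sigmaFun_rel q hδ hlam)

/-! ### The modules `L_n` -/

/-- The basis vectors `v_0, …, v_n` of `L_n = ℂ^{n+1}`, with `v_i = 0` for `i > n`. -/
def Lvec (n i : ℕ) : Fin (n + 1) → ℂ :=
  if h : i < n + 1 then Pi.single ⟨i, h⟩ 1 else 0

/-- The linear endomorphism of `L_n` with prescribed values on the basis `v_0, …, v_n`. -/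
def LEnd (n : ℕ) (f : ℕ → Fin (n + 1) → ℂ) : Module.End ℂ (Fin (n + 1) → ℂ) :=
  (Pi.basisFun ℂ (Fin (n + 1))).constr ℂ fun i => f i

/-- The action of the generators on `L_n`: `E v_0 = 0`, `E v_i = [i]_q [n-i+1]_q v_{i-1}` for
`1 ≤ i ≤ n`, `F v_i = v_{i+1}` for `i < n`, `F v_n = 0`, and `K^{±1} v_i = q^{±(n-2i)} v_i`. -/
def LFun (q : ℂ) (n : ℕ) : UGen → Module.End ℂ (Fin (n + 1) → ℂ)
  | .E => LEnd n fun i =>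
      if i = 0 then 0 else (qInt q i * qInt q ((n : ℤ) - i + 1)) • Lvec n (i - 1)
  | .F => LEnd n fun i => Lvec n (i + 1)
  | .K => LEnd n fun i => q ^ ((n : ℤ) - 2 * i) • Lvec n i
  | .Ki => LEnd n fun i => q ^ (-((n : ℤ) - 2 * i)) • Lvec n i

theorem LEnd_Lvec (n : ℕ) (f : ℕ → Fin (n + 1) → ℂ) (i : ℕ) (hi : i ≤ n) :
    LEnd n f (Lvec n i) = f i := by
  have h : Lvec n i = Pi.basisFun ℂ (Fin (n + 1)) ⟨i, by omega⟩ := by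
    rw [Lvec, dif_pos (by omega), Pi.basisFun_apply]
  rw [h, LEnd, Module.Basis.constr_basis]

theorem Lvec_of_lt (n i : ℕ) (hi : n < i) : Lvec n i = 0 := by
  rw [Lvec, dif_neg (by omega)]

theorem L_ext (n : ℕ) {f g : Module.End ℂ (Fin (n + 1) → ℂ)}
    (h : ∀ i ≤ n, f (Lvec n i) = g (Lvec n i)) : f = g := by
  refine (Pi.basisFun ℂ (Fin (n + 1))).ext fun i => ?_
  have := h i (by omega)
  rw [Lvec, dif_pos i.2] at this
  simpa using this

theorem qInt_identity {q : ℂ} (hq : q ≠ 0) (n i : ℤ) :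
    qInt q (i + 1) * qInt q (n - i) - qInt q i * qInt q (n - i + 1) =
      (q - q⁻¹)⁻¹ * (q ^ (n - 2 * i) - q ^ (-(n - 2 * i))) := by
  simp only [qInt]
  by_cases h : q - q⁻¹ = 0
  · simp [h]
  · have h2 : n - 2 * i = n - i - i := by ring
    have hi := zpow_ne_zero i hq
    have hn := zpow_ne_zero n hq
    rw [h2]
    simp only [neg_sub, neg_add, zpow_add₀ hq, zpow_sub₀ hq, zpow_neg, zpow_one]
    generalize q ^ i = a at *
    generalize q ^ n = b at *
    have h3 : q ^ 2 - 1 ≠ 0 := by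
      intro h3
      apply h
      field_simp
      linear_combination h3
    field_simp
    ring

theorem LFun_rel {q : ℂ} (hq : q ≠ 0) (n : ℕ) ⦃a b : FreeAlgebra ℂ UGen⦄ (h : URel q a b) :
    FreeAlgebra.lift ℂ (LFun q n) a = FreeAlgebra.lift ℂ (LFun q n) b := by
  cases h
  all_goals
    simp only [qBracket, Ring.lie_def, map_sub, map_smul, map_mul, map_one, map_zero,
      FreeAlgebra.lift_ι_apply]
    refine L_ext n fun i hi => ?_
    simp only [LFun, Module.End.mul_apply, LinearMap.sub_apply, LinearMap.smul_apply,
      LEnd_Lvec n _ i hi, Module.End.one_apply, LinearMap.zero_apply, map_smul]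
  case K_Ki =>
    rw [smul_smul, ← zpow_add₀ hq]
    simp
  case Ki_K =>
    rw [smul_smul, ← zpow_add₀ hq]
    simp
  case E_K =>
    rcases i with _ | i
    · simp
    · simp only [Nat.add_eq_zero_iff, one_ne_zero, and_false, if_false, map_smul,
        Nat.add_sub_cancel]
      rw [LEnd_Lvec n _ i (by omega), smul_smul, smul_smul, smul_smul, smul_smul, ← sub_smul]
      convert zero_smul ℂ _
      have : (n : ℤ) - 2 * i = n - 2 * (i + 1 : ℕ) + 1 + 1 := by push_cast; ring
      rw [this, zpow_add₀ hq, zpow_add₀ hq]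
      field_simp
      ring
  case K_F =>
    rcases hi.lt_or_eq with h | rfl
    · rw [LEnd_Lvec n _ (i + 1) h, smul_smul, smul_smul, ← sub_smul]
      convert zero_smul ℂ _
      have : (n : ℤ) - 2 * i = n - 2 * (i + 1 : ℕ) + 1 + 1 := by push_cast; ring
      rw [this, zpow_add₀ hq, zpow_add₀ hq]
      field_simp
      ring
    · simp [Lvec_of_lt]
  case E_F =>
    have h1 : (LEnd n fun i => if i = 0 then 0 else
        (qInt q i * qInt q ((n : ℤ) - i + 1)) • Lvec n (i - 1)) (Lvec n (i + 1)) =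
        (qInt q (i + 1) * qInt q (n - i)) • Lvec n i := by
      rcases hi.lt_or_eq with h | rfl
      · have h3 : (n : ℤ) - (i + 1) + 1 = n - i := by ring
        rw [LEnd_Lvec n _ (i + 1) h]
        simp [h3]
      · simp [Lvec_of_lt, qInt]
    have h2 : (LEnd n fun i => Lvec n (i + 1)) (if i = 0 then 0 else
        (qInt q i * qInt q ((n : ℤ) - i + 1)) • Lvec n (i - 1)) =
        (qInt q i * qInt q ((n : ℤ) - i + 1)) • Lvec n i := by
      rcases i with _ | i
      · simp [qInt]
      · simp only [Nat.add_eq_zero_iff, one_ne_zero, and_false, if_false, map_smul,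
          Nat.add_sub_cancel]
        rw [LEnd_Lvec n _ i (by omega)]
    rw [h1, h2, ← sub_smul, ← sub_smul, smul_smul, qInt_identity hq]

/-- The representation of `U_q(sl₂)` on the `(n+1)`-dimensional module `L_n`. -/
def repL {q : ℂ} (hq : q ≠ 0) (n : ℕ) : Uq q →ₐ[ℂ] Module.End ℂ (Fin (n + 1) → ℂ) :=
  Uq.lift (LFun q n) (LFun_rel hq n)

/-- The representation of `U_q(sl₂) ⊗ U_q(sl₂)` on `L_m ⊗ L_n`: `x ⊗ y` acts as
`v ⊗ w ↦ x v ⊗ y w`. -/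
def repTensor {q : ℂ} (hq : q ≠ 0) (m n : ℕ) :
    Uq q ⊗[ℂ] Uq q →ₐ[ℂ] Module.End ℂ ((Fin (m + 1) → ℂ) ⊗[ℂ] (Fin (n + 1) → ℂ)) :=
  (Module.endTensorEndAlgHom (R := ℂ) (S := ℂ) (A := ℂ)).comp
    (Algebra.TensorProduct.map (repL hq m) (repL hq n))

/-! ### The `W_q`-modules `(L_m ⊗ L_n)^{δ,lam}` -/

/-- The representation of `W_q` on `(L_m ⊗ L_n)^{δ,lam}`: the representation on `L_m ⊗ L_n`
pulled back via `♭`, then twisted via `σ_{δ,lam}`. -/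
def repW {q : ℂ} (hq : q ≠ 0) (p : Quad) :
    Wq q →ₐ[ℂ] Module.End ℂ ((Fin (p.m + 1) → ℂ) ⊗[ℂ] (Fin (p.n + 1) → ℂ)) :=
  ((repTensor hq p.m p.n).comp (flat q)).comp (sigma q p.hδ p.hlam)

/-- The underlying vector space of `(L_m ⊗ L_n)^{δ,lam}`. -/
def LL {q : ℂ} (_hq : q ≠ 0) (p : Quad) : Type :=
  (Fin (p.m + 1) → ℂ) ⊗[ℂ] (Fin (p.n + 1) → ℂ)

instance {q : ℂ} (hq : q ≠ 0) (p : Quad) : AddCommGroup (LL hq p) :=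
  inferInstanceAs (AddCommGroup ((Fin (p.m + 1) → ℂ) ⊗[ℂ] (Fin (p.n + 1) → ℂ)))

instance {q : ℂ} (hq : q ≠ 0) (p : Quad) : Module ℂ (LL hq p) :=
  inferInstanceAs (Module ℂ ((Fin (p.m + 1) → ℂ) ⊗[ℂ] (Fin (p.n + 1) → ℂ)))

/-- The `W_q`-module structure of `(L_m ⊗ L_n)^{δ,lam}`. -/
instance {q : ℂ} (hq : q ≠ 0) (p : Quad) : Module (Wq q) (LL hq p) :=
  Module.compHom ((Fin (p.m + 1) → ℂ) ⊗[ℂ] (Fin (p.n + 1) → ℂ)) (repW hq p).toRingHom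

theorem LL_smul_def {q : ℂ} (hq : q ≠ 0) (p : Quad) (x : Wq q) (v : LL hq p) :
    x • v = repW hq p x v := rfl

instance {q : ℂ} (hq : q ≠ 0) (p : Quad) : IsScalarTower ℂ (Wq q) (LL hq p) :=
  ⟨fun c x v => by rw [LL_smul_def, LL_smul_def, map_smul]; rfl⟩

/-! ### Isomorphism classes -/

/-- Isomorphism classes of all `W_q`-modules in a given universe. -/
abbrev ModClass (q : ℂ) : Type (u + 1) :=
  Quotient (CategoryTheory.isIsomorphicSetoid (ModuleCat.{u} (Wq q)))

/-- The isomorphism class of a `W_q`-module. -/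
def modClass (q : ℂ) (V : Type u) [AddCommGroup V] [Module (Wq q) V] : ModClass.{u} q :=
  Quotient.mk _ (ModuleCat.of (Wq q) V)

/-- The set of isomorphism classes of the finite-dimensional irreducible `W_q`-modules. -/
def finDimIrrClasses (q : ℂ) : Set (ModClass.{u} q) :=
  {c | ∃ (V : Type u) (_ : AddCommGroup V) (_ : Module ℂ V) (_ : Module (Wq q) V)
    (_ : IsScalarTower ℂ (Wq q) V),
    FiniteDimensional ℂ V ∧ IsSimpleModule (Wq q) V ∧ c = modClass q V}

/-- The map sending `(m, n, δ, lam)` to the isomorphism class of `(L_m ⊗ L_n)^{δ,lam}`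
(a copy of it in the given universe). -/
def quadClass {q : ℂ} (hq : q ≠ 0) (p : Quad) : ModClass.{u} q :=
  modClass q (ULift.{u} (LL hq p))

end QuantumCovering

end

namespace QuantumCovering

/-! ### Relations between the generators of `W_q` -/

section Relations

variable (q : ℂ)

/-! This is highest weight theory for two commuting copies of `U_q(sl₂)` coupled through the central
element `I`. In a nonzero submodule of a finite-dimensional module, the commuting operators `I`,
`K₂`, `K₁` have a common eigenvector. Each `E_i` multiplies the `K_i`-eigenvalue by `q²`, which has
infinite order, so powers of `E₁` and then of `E₂` lead to a nonzero `v` killed by both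
(`exists_isHighestWeight`).

Let `a`, `b`, `c` be the eigenvalues of `K₁`, `K₂`, `I` on `v`, and let `F₁^m v`, `F₂^n v` be the
last nonzero vectors of the two ladders. Applying `E₁` to `F₁^(m+1) v = 0` and `E₂` to `F₂^(n+1) v =
0` forces `a² = c q^(2m)` and `c b² = q^(2n)` (`raise_pow_succ_smul_of_finite`). Hence `λ = a
q^(-m)` satisfies `λ² = c`, and `δ = b q^(-n) λ` satisfies `δ² = 1` (`IsHighestWeight.exists_quad`).
The map `v_i ⊗ v_j ↦ F₁^i F₂^j v` is then a nonzero `W_q`-linear map (`ladderMap_smul`), and Schur's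
lemma makes it an isomorphism onto an irreducible module.

Irreducibility and uniqueness both rest on `exists_eq_smul_LLvec_zero`: in `(L_m ⊗ L_n)^{δ,λ}` only
the multiples of `v_0 ⊗ v_0` are killed by `E₁` and `E₂`. An isomorphism therefore preserves the
eigenvalues `λ²`, `λ q^m`, `δ λ⁻¹ q^n` on that line, and these determine `(m, n, δ, λ)`. -/

theorem Wq.I_comm (x : Wq q) : Wq.gen q .I * x = x * Wq.gen q .I := by
  obtain ⟨a, rfl⟩ := Wq.mk_surjective q x
  simpa [Wq.gen] using Wq.mk_rel q (WRel.I_central a)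

theorem Wq.K1_K1i : Wq.gen q .K1 * Wq.gen q .K1i = 1 := by
  simpa [Wq.gen] using Wq.mk_rel q WRel.K1_K1i

theorem Wq.K2_K2i : Wq.gen q .K2 * Wq.gen q .K2i = 1 := by
  simpa [Wq.gen] using Wq.mk_rel q WRel.K2_K2i

theorem Wq.I_Ii : Wq.gen q .I * Wq.gen q .Ii = 1 := by
  simpa [Wq.gen] using Wq.mk_rel q WRel.I_Ii

theorem Wq.Ii_I : Wq.gen q .Ii * Wq.gen q .I = 1 := by
  simpa [Wq.gen] using Wq.mk_rel q WRel.Ii_I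

theorem Wq.K1i_K1 : Wq.gen q .K1i * Wq.gen q .K1 = 1 := by
  simpa [Wq.gen] using Wq.mk_rel q WRel.K1i_K1

theorem Wq.K2i_K2 : Wq.gen q .K2i * Wq.gen q .K2 = 1 := by
  simpa [Wq.gen] using Wq.mk_rel q WRel.K2i_K2

theorem Wq.K1_E2 : Wq.gen q .K1 * Wq.gen q .E2 = Wq.gen q .E2 * Wq.gen q .K1 := by
  simpa [Wq.gen, Ring.lie_def, sub_eq_zero] using Wq.mk_rel q WRel.K1_E2

theorem Wq.K1_F2 : Wq.gen q .K1 * Wq.gen q .F2 = Wq.gen q .F2 * Wq.gen q .K1 := by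
  simpa [Wq.gen, Ring.lie_def, sub_eq_zero] using Wq.mk_rel q WRel.K1_F2

theorem Wq.K1_K2 : Wq.gen q .K1 * Wq.gen q .K2 = Wq.gen q .K2 * Wq.gen q .K1 := by
  simpa [Wq.gen, Ring.lie_def, sub_eq_zero] using Wq.mk_rel q WRel.K1_K2

theorem Wq.K2_E1 : Wq.gen q .K2 * Wq.gen q .E1 = Wq.gen q .E1 * Wq.gen q .K2 := by
  simpa [Wq.gen, Ring.lie_def, sub_eq_zero] using Wq.mk_rel q WRel.K2_E1

theorem Wq.K2_F1 : Wq.gen q .K2 * Wq.gen q .F1 = Wq.gen q .F1 * Wq.gen q .K2 := by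
  simpa [Wq.gen, Ring.lie_def, sub_eq_zero] using Wq.mk_rel q WRel.K2_F1

theorem Wq.E1_E2 : Wq.gen q .E1 * Wq.gen q .E2 = Wq.gen q .E2 * Wq.gen q .E1 := by
  simpa [Wq.gen, Ring.lie_def, sub_eq_zero] using Wq.mk_rel q WRel.E1_E2

theorem Wq.E1_F2 : Wq.gen q .E1 * Wq.gen q .F2 = Wq.gen q .F2 * Wq.gen q .E1 := by
  simpa [Wq.gen, Ring.lie_def, sub_eq_zero] using Wq.mk_rel q WRel.E1_F2

theorem Wq.F1_E2 : Wq.gen q .F1 * Wq.gen q .E2 = Wq.gen q .E2 * Wq.gen q .F1 := by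
  simpa [Wq.gen, Ring.lie_def, sub_eq_zero] using Wq.mk_rel q WRel.F1_E2

theorem Wq.F1_F2 : Wq.gen q .F1 * Wq.gen q .F2 = Wq.gen q .F2 * Wq.gen q .F1 := by
  simpa [Wq.gen, Ring.lie_def, sub_eq_zero] using Wq.mk_rel q WRel.F1_F2

theorem Wq.E1_K1 : qBracket q (Wq.gen q .E1) (Wq.gen q .K1) = 0 := by
  simpa [Wq.gen, qBracket] using Wq.mk_rel q WRel.E1_K1

theorem Wq.K1_F1 : qBracket q (Wq.gen q .K1) (Wq.gen q .F1) = 0 := by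
  simpa [Wq.gen, qBracket] using Wq.mk_rel q WRel.K1_F1

theorem Wq.E2_K2 : qBracket q (Wq.gen q .E2) (Wq.gen q .K2) = 0 := by
  simpa [Wq.gen, qBracket] using Wq.mk_rel q WRel.E2_K2

theorem Wq.K2_F2 : qBracket q (Wq.gen q .K2) (Wq.gen q .F2) = 0 := by
  simpa [Wq.gen, qBracket] using Wq.mk_rel q WRel.K2_F2

theorem Wq.E1_F1 : Wq.gen q .E1 * Wq.gen q .F1 - Wq.gen q .F1 * Wq.gen q .E1 =
    (q - q⁻¹)⁻¹ • (Wq.gen q .K1 - Wq.gen q .I * Wq.gen q .K1i) := by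
  simpa [Wq.gen, Ring.lie_def] using Wq.mk_rel q WRel.E1_F1

theorem Wq.E2_F2 : Wq.gen q .E2 * Wq.gen q .F2 - Wq.gen q .F2 * Wq.gen q .E2 =
    (q - q⁻¹)⁻¹ • (Wq.gen q .I * Wq.gen q .K2 - Wq.gen q .K2i) := by
  simpa [Wq.gen, Ring.lie_def] using Wq.mk_rel q WRel.E2_F2

variable {q}

/-- This and the next lemma rewrite the `q`-commutation relations with `K` moved to the left, as `K
E = q² E K` and `K F = q⁻² F K`, so that the shift of `K`-eigenvalues is visible. -/
theorem qBracket_eq_zero_iff_left {A : Type*} [Ring A] [Algebra ℂ A] (hq : q ≠ 0) {x y : A} :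
    qBracket q x y = 0 ↔ y * x = q ^ 2 • (x * y) := by
  rw [qBracket, sub_eq_zero, eq_comm, inv_smul_eq_iff₀ hq, smul_smul, pow_two]

theorem qBracket_eq_zero_iff_right {A : Type*} [Ring A] [Algebra ℂ A] (hq : q ≠ 0) {x y : A} :
    qBracket q x y = 0 ↔ x * y = (q ^ 2)⁻¹ • (y * x) := by
  rw [qBracket, sub_eq_zero, eq_inv_smul_iff₀ (pow_ne_zero 2 hq), eq_inv_smul_iff₀ hq, smul_smul,
    pow_two]

/-- The generators of `W_q` generate it as an algebra. -/
theorem Wq.induction_on {P : Wq q → Prop} (halg : ∀ c, P (algebraMap ℂ (Wq q) c))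
    (hgen : ∀ x, P (Wq.gen q x)) (hmul : ∀ x y, P x → P y → P (x * y))
    (hadd : ∀ x y, P x → P y → P (x + y)) (x : Wq q) : P x := by
  obtain ⟨a, rfl⟩ := Wq.mk_surjective q x
  induction a using FreeAlgebra.induction with
  | grade0 c => simpa using halg c
  | grade1 y => exact hgen y
  | mul a b ha hb => rw [map_mul]; exact hmul _ _ ha hb
  | add a b ha hb => rw [map_add]; exact hadd _ _ ha hb

end Relations

/-! ### The action of the generators on `(L_m ⊗ L_n)^{δ,lam}` -/

section Action

variable {q : ℂ} (hq : q ≠ 0) (p : Quad)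

/-- The vector `v_i ⊗ v_j` of `(L_m ⊗ L_n)^{δ,lam}`. -/
noncomputable def LLvec (i j : ℕ) : LL hq p := (Lvec p.m i ⊗ₜ[ℂ] Lvec p.n j :)

theorem repW_gen (x : WGen) : repW hq p (Wq.gen q x) =
    repTensor hq p.m p.n (flat q (sigmaFun q p.δ p.lam x)) := by
  simp only [repW, AlgHom.comp_apply, sigma, Wq.lift_gen]

theorem repTensor_tmul (m n : ℕ) (x y : Uq q) (v : Fin (m + 1) → ℂ) (w : Fin (n + 1) → ℂ) :
    repTensor hq m n (x ⊗ₜ y) (v ⊗ₜ w) = repL hq m x v ⊗ₜ repL hq n y w := rfl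

theorem repTensor_flat_gen (m n : ℕ) (x : WGen) :
    repTensor hq m n (flat q (Wq.gen q x)) = repTensor hq m n (flatFun q x) := by
  rw [flat, Wq.lift_gen]

theorem repL_gen (n : ℕ) (x : UGen) : repL hq n (Uq.gen q x) = LFun q n x := by
  rw [repL, Uq.lift_gen]

/-- Setting out-of-range vectors to zero lets the formulas for `F₁` and `F₂` hold at the end of each
ladder without a separate case. -/
theorem LLvec_eq_zero_left {i : ℕ} (hi : p.m < i) (j : ℕ) : LLvec hq p i j = 0 := by
  rw [LLvec, Lvec_of_lt _ _ hi]; exact TensorProduct.zero_tmul _ _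

theorem LLvec_eq_zero_right (i : ℕ) {j : ℕ} (hj : p.n < j) : LLvec hq p i j = 0 := by
  rw [LLvec, Lvec_of_lt _ _ hj]; exact TensorProduct.tmul_zero _ _

theorem E1_smul_LLvec_zero (j : ℕ) : Wq.gen q .E1 • LLvec hq p 0 j = 0 := by
  change repW hq p (Wq.gen q .E1) (Lvec p.m 0 ⊗ₜ Lvec p.n j) = 0
  rw [repW_gen, sigmaFun, map_smul, map_smul, repTensor_flat_gen, flatFun, LinearMap.smul_apply,
    repTensor_tmul, repL_gen, LFun, LEnd_Lvec _ _ _ (Nat.zero_le _), if_pos rfl,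
    TensorProduct.zero_tmul, smul_zero]

theorem E1_smul_LLvec_succ {i : ℕ} (hi : i + 1 ≤ p.m) (j : ℕ) :
    Wq.gen q .E1 • LLvec hq p (i + 1) j =
      (p.lam * (qInt q (i + 1) * qInt q (p.m - i))) • LLvec hq p i j := by
  change repW hq p (Wq.gen q .E1) (Lvec p.m (i + 1) ⊗ₜ Lvec p.n j) =
    (p.lam * (qInt q (i + 1) * qInt q (p.m - i))) • (Lvec p.m i ⊗ₜ[ℂ] Lvec p.n j)
  have : (p.m : ℤ) - ((i + 1 : ℕ) : ℤ) + 1 = p.m - i := by push_cast; ring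
  rw [repW_gen, sigmaFun, map_smul, map_smul, repTensor_flat_gen, flatFun, LinearMap.smul_apply,
    repTensor_tmul, repL_gen, LFun, LEnd_Lvec _ _ _ hi, map_one, if_neg (Nat.succ_ne_zero _),
    Nat.add_sub_cancel, this, Module.End.one_apply, ← TensorProduct.smul_tmul',
    smul_smul, Nat.cast_succ]

theorem E2_smul_LLvec_zero (i : ℕ) : Wq.gen q .E2 • LLvec hq p i 0 = 0 := by
  change repW hq p (Wq.gen q .E2) (Lvec p.m i ⊗ₜ Lvec p.n 0) = 0
  rw [repW_gen, sigmaFun, map_smul, map_smul, repTensor_flat_gen, flatFun, LinearMap.smul_apply,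
    repTensor_tmul, repL_gen, LFun, LEnd_Lvec _ _ _ (Nat.zero_le _), if_pos rfl,
    TensorProduct.tmul_zero, smul_zero]

theorem E2_smul_LLvec_succ (i : ℕ) {j : ℕ} (hj : j + 1 ≤ p.n) :
    Wq.gen q .E2 • LLvec hq p i (j + 1) =
      (p.δ * p.lam * (qInt q (j + 1) * qInt q (p.n - j))) • LLvec hq p i j := by
  change repW hq p (Wq.gen q .E2) (Lvec p.m i ⊗ₜ Lvec p.n (j + 1)) =
    (p.δ * p.lam * (qInt q (j + 1) * qInt q (p.n - j))) • (Lvec p.m i ⊗ₜ[ℂ] Lvec p.n j)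
  have : (p.n : ℤ) - ((j + 1 : ℕ) : ℤ) + 1 = p.n - j := by push_cast; ring
  rw [repW_gen, sigmaFun, map_smul, map_smul, repTensor_flat_gen, flatFun, LinearMap.smul_apply,
    repTensor_tmul, repL_gen, LFun, LEnd_Lvec _ _ _ hj, map_one, if_neg (Nat.succ_ne_zero _),
    Nat.add_sub_cancel, this, Module.End.one_apply, TensorProduct.tmul_smul,
    smul_smul, Nat.cast_succ]

theorem F1_smul_LLvec {i : ℕ} (hi : i ≤ p.m) (j : ℕ) :
    Wq.gen q .F1 • LLvec hq p i j = LLvec hq p (i + 1) j := by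
  change repW hq p (Wq.gen q .F1) (Lvec p.m i ⊗ₜ Lvec p.n j) =
    Lvec p.m (i + 1) ⊗ₜ[ℂ] Lvec p.n j
  rw [repW_gen, sigmaFun, repTensor_flat_gen, flatFun, repTensor_tmul, repL_gen, LFun,
    LEnd_Lvec _ _ _ hi, map_one, Module.End.one_apply]

theorem F2_smul_LLvec (i : ℕ) {j : ℕ} (hj : j ≤ p.n) :
    Wq.gen q .F2 • LLvec hq p i j = LLvec hq p i (j + 1) := by
  change repW hq p (Wq.gen q .F2) (Lvec p.m i ⊗ₜ Lvec p.n j) =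
    Lvec p.m i ⊗ₜ[ℂ] Lvec p.n (j + 1)
  rw [repW_gen, sigmaFun, repTensor_flat_gen, flatFun, repTensor_tmul, repL_gen, LFun,
    LEnd_Lvec _ _ _ hj, map_one, Module.End.one_apply]

theorem K1_smul_LLvec {i : ℕ} (hi : i ≤ p.m) (j : ℕ) :
    Wq.gen q .K1 • LLvec hq p i j = (p.lam * q ^ ((p.m : ℤ) - 2 * i)) • LLvec hq p i j := by
  change repW hq p (Wq.gen q .K1) (Lvec p.m i ⊗ₜ Lvec p.n j) =
    (p.lam * q ^ ((p.m : ℤ) - 2 * i)) • (Lvec p.m i ⊗ₜ[ℂ] Lvec p.n j)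
  rw [repW_gen, sigmaFun, map_smul, map_smul, repTensor_flat_gen, flatFun, LinearMap.smul_apply,
    repTensor_tmul, repL_gen, LFun, LEnd_Lvec _ _ _ hi, map_one, Module.End.one_apply,
    ← TensorProduct.smul_tmul', smul_smul]

theorem K2_smul_LLvec (i : ℕ) {j : ℕ} (hj : j ≤ p.n) :
    Wq.gen q .K2 • LLvec hq p i j =
      (p.δ * p.lam⁻¹ * q ^ ((p.n : ℤ) - 2 * j)) • LLvec hq p i j := by
  change repW hq p (Wq.gen q .K2) (Lvec p.m i ⊗ₜ Lvec p.n j) =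
    (p.δ * p.lam⁻¹ * q ^ ((p.n : ℤ) - 2 * j)) • (Lvec p.m i ⊗ₜ[ℂ] Lvec p.n j)
  rw [repW_gen, sigmaFun, map_smul, map_smul, repTensor_flat_gen, flatFun, LinearMap.smul_apply,
    repTensor_tmul, repL_gen, LFun, LEnd_Lvec _ _ _ hj, map_one, Module.End.one_apply,
    TensorProduct.tmul_smul, smul_smul]

/-- Since `flat` sends `I` to `1`, only the scalar of the twist remains. -/
theorem I_smul (x : LL hq p) : Wq.gen q .I • x = p.lam ^ 2 • x := by
  rw [LL_smul_def, repW_gen, sigmaFun, map_smul, map_smul, repTensor_flat_gen, flatFun, map_one]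
  rfl

/-- The basis of `(L_m ⊗ L_n)^{δ,lam}` formed by the vectors `v_i ⊗ v_j`. -/
noncomputable def LLbasis : Module.Basis (Fin (p.m + 1) × Fin (p.n + 1)) ℂ (LL hq p) :=
  (Pi.basisFun ℂ (Fin (p.m + 1))).tensorProduct (Pi.basisFun ℂ (Fin (p.n + 1)))

theorem LLbasis_apply (k : Fin (p.m + 1) × Fin (p.n + 1)) :
    LLbasis hq p k = LLvec hq p k.1 k.2 := by
  rw [LLbasis, LLvec, Lvec, Lvec, dif_pos k.1.2, dif_pos k.2.2]
  refine (Module.Basis.tensorProduct_apply' _ _ _).trans ?_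
  simp

instance : FiniteDimensional ℂ (LL hq p) := (LLbasis hq p).finiteDimensional_of_finite

theorem LLvec_zero_ne_zero : LLvec hq p 0 0 ≠ 0 := by
  have := (LLbasis hq p).ne_zero (0, 0)
  rwa [LLbasis_apply] at this

instance : Nontrivial (LL hq p) := ⟨_, _, LLvec_zero_ne_zero hq p⟩

/-- The action of an element of `W_q`, as a linear map over `ℂ`. -/
noncomputable abbrev actL (q : ℂ) (V : Type*) [AddCommGroup V] [Module ℂ V] [Module (Wq q) V]
    [IsScalarTower ℂ (Wq q) V] : Wq q →ₐ[ℂ] Module.End ℂ V :=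
  Algebra.lsmul ℂ ℂ V

end Action

/-! ### Nonvanishing of `q`-integers -/

section QInt

variable {q : ℂ}

theorem zpow_ne_one (hq : ∀ k : ℕ, 0 < k → q ^ k ≠ 1) {k : ℤ} (hk : k ≠ 0) : q ^ k ≠ 1 := by
  intro h
  rcases Int.natAbs_eq k with h1 | h1
  · rw [h1, zpow_natCast] at h
    exact hq _ (Int.natAbs_pos.2 hk) h
  · rw [h1, zpow_neg, inv_eq_one, zpow_natCast] at h
    exact hq _ (Int.natAbs_pos.2 hk) h

theorem zpow_injective_of_not_root (hq0 : q ≠ 0) (hq : ∀ k : ℕ, 0 < k → q ^ k ≠ 1) :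
    Function.Injective fun k : ℤ => q ^ k := by
  intro i j (h : q ^ i = q ^ j)
  by_contra hij
  exact zpow_ne_one hq (sub_ne_zero.2 hij)
    (by rw [zpow_sub₀ hq0, h, div_self (zpow_ne_zero _ hq0)])

theorem sub_inv_ne_zero (hq0 : q ≠ 0) (hq : ∀ k : ℕ, 0 < k → q ^ k ≠ 1) : q - q⁻¹ ≠ 0 := by
  intro h
  refine hq 2 two_pos ?_
  rw [sub_eq_zero] at h
  rw [pow_two]
  nth_rw 1 [h]
  exact inv_mul_cancel₀ hq0

theorem qInt_ne_zero (hq0 : q ≠ 0) (hq : ∀ k : ℕ, 0 < k → q ^ k ≠ 1) {k : ℤ} (hk : k ≠ 0) :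
    qInt q k ≠ 0 := by
  refine div_ne_zero (fun h => hk ?_) (sub_inv_ne_zero hq0 hq)
  have := zpow_injective_of_not_root hq0 hq (sub_eq_zero.1 h)
  omega

end QInt

/-! ### Highest weight vectors -/

section HighestWeight

/-- A ladder operator applied to an eigenvector of a finite-dimensional space eventually
gives zero. -/
theorem exists_pow_ne_zero_pow_succ_eq_zero {V : Type*} [AddCommGroup V] [Module ℂ V]
    [FiniteDimensional ℂ V] {K E : Module.End ℂ V} {μ a : ℂ} {v : V} (hμ0 : μ ≠ 0)
    (hμ : ∀ k : ℕ, 0 < k → μ ^ k ≠ 1) (hKE : K * E = μ • (E * K)) (hv : v ≠ 0)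
    (hKv : K v = a • v) (ha : a ≠ 0) : ∃ k : ℕ, (E ^ k) v ≠ 0 ∧ (E ^ (k + 1)) v = 0 := by
  have hK : ∀ k : ℕ, K ((E ^ k) v) = (μ ^ k * a) • (E ^ k) v := by
    intro k
    induction k with
    | zero => simpa using hKv
    | succ k ih =>
      rw [pow_succ' E, Module.End.mul_apply]
      have := LinearMap.congr_fun hKE ((E ^ k) v)
      simp only [Module.End.mul_apply, LinearMap.smul_apply] at this
      rw [this, ih, map_smul, smul_smul, pow_succ' μ, mul_assoc]
  have hex : ∃ k : ℕ, (E ^ k) v = 0 := by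
    -- The eigenvalues `μ ^ k * a` are pairwise distinct, so if no `(E ^ k) v` vanished, these
    -- vectors would form an infinite linearly independent family.
    by_contra! h
    have hinj : Function.Injective fun k : ℕ => μ ^ k * a := by
      intro i j hij
      have h1 : μ ^ (i : ℤ) = μ ^ (j : ℤ) := by
        simpa only [zpow_natCast] using mul_right_cancel₀ ha hij
      exact_mod_cast zpow_injective_of_not_root hμ0 hμ h1
    have := Module.End.eigenvectors_linearIndependent' K _ hinj (fun k => (E ^ k) v)
      fun k => ⟨Module.End.mem_eigenspace_iff.2 (hK k), h k⟩
    exact not_finite_iff_infinite.2 inferInstance this.finite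
  classical
  -- The first vanishing exponent is positive because `v ≠ 0`; its predecessor is the required `k`.
  have h0 : Nat.find hex ≠ 0 := fun h => hv (by simpa [h] using Nat.find_spec hex)
  obtain ⟨k, hk⟩ := Nat.exists_eq_succ_of_ne_zero h0
  exact ⟨k, Nat.find_min hex (by omega), by simpa [hk] using Nat.find_spec hex⟩

/-- An endomorphism preserving a nonzero subspace has an eigenvector in it. -/
theorem exists_eigenvector_mem {V : Type*} [AddCommGroup V] [Module ℂ V] [FiniteDimensional ℂ V]
    (f : Module.End ℂ V) {W : Submodule ℂ V} (hW : W ≠ ⊥) (hf : ∀ x ∈ W, f x ∈ W) :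
    ∃ a : ℂ, W ⊓ f.eigenspace a ≠ ⊥ := by
  have : Nontrivial W := Submodule.nontrivial_iff_ne_bot.2 hW
  obtain ⟨a, ha⟩ := Module.End.exists_eigenvalue (f.restrict hf)
  obtain ⟨x, hx⟩ := ha.exists_hasEigenvector
  refine ⟨a, fun h => hx.2 ?_⟩
  have h1 : (x : V) ∈ W ⊓ f.eigenspace a :=
    ⟨x.2, Module.End.mem_eigenspace_iff.2 (congrArg Subtype.val hx.apply_eq_smul)⟩
  rw [h, Submodule.mem_bot] at h1
  exact Subtype.ext h1

theorem eigenvalue_ne_zero {A V : Type*} [Ring A] [AddCommGroup V] [Module ℂ V] [Module A V]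
    {x y : A} (h : y * x = 1) {v : V} (hv0 : v ≠ 0) {a : ℂ}
    (hv : x • v = a • v) : a ≠ 0 := by
  rintro rfl
  apply hv0
  rw [← one_smul A v, ← h, mul_smul, hv, zero_smul, smul_zero]

variable {q : ℂ} {V : Type*} [AddCommGroup V] [Module ℂ V] [Module (Wq q) V]

/-- A nonzero vector killed by `E₁` and `E₂` on which `K₁`, `K₂`, `I` act as the scalars
`a`, `b`, `c`. -/
structure IsHighestWeight (v : V) (a b c : ℂ) : Prop where
  ne_zero : v ≠ 0
  E1 : Wq.gen q .E1 • v = 0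
  E2 : Wq.gen q .E2 • v = 0
  K1 : Wq.gen q .K1 • v = a • v
  K2 : Wq.gen q .K2 • v = b • v
  I : Wq.gen q .I • v = c • v

theorem IsHighestWeight.a_ne_zero {v : V} {a b c : ℂ}
    (hv : IsHighestWeight (q := q) v a b c) : a ≠ 0 :=
  eigenvalue_ne_zero (Wq.K1i_K1 q) hv.ne_zero hv.K1

theorem IsHighestWeight.b_ne_zero {v : V} {a b c : ℂ}
    (hv : IsHighestWeight (q := q) v a b c) : b ≠ 0 :=
  eigenvalue_ne_zero (Wq.K2i_K2 q) hv.ne_zero hv.K2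

variable [IsScalarTower ℂ (Wq q) V]

theorem smul_eq_inv_smul {x y : Wq q} (h : y * x = 1) {v : V} {a : ℂ} (ha : a ≠ 0)
    (hv : x • v = a • v) : y • v = a⁻¹ • v := by
  rw [eq_inv_smul_iff₀ ha, ← algebraMap_smul (Wq q) a (y • v), ← mul_smul, Algebra.commutes,
    mul_smul, algebraMap_smul, ← hv, ← mul_smul, h, one_smul]

theorem mul_pow_eq_smul {A : Type*} [Ring A] [Algebra ℂ A] {x y : A} {μ : ℂ}
    (h : x * y = μ • (y * x)) (k : ℕ) : x * y ^ k = μ ^ k • (y ^ k * x) := by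
  induction k with
  | zero => simp
  | succ k ih =>
    rw [pow_succ y, ← mul_assoc, ih, smul_mul_assoc, mul_assoc, h, mul_smul_comm, smul_smul,
      ← mul_assoc, pow_succ μ]

theorem smul_pow_smul_of_qcomm {x y : Wq q} {μ a : ℂ} (h : x * y = μ • (y * x)) {v : V}
    (hv : x • v = a • v) (k : ℕ) : x • y ^ k • v = (μ ^ k * a) • y ^ k • v := by
  rw [← mul_smul, mul_pow_eq_smul h, smul_assoc, mul_smul, hv, smul_algebra_smul_comm, smul_smul]

theorem smul_smul_of_comm {x y : Wq q} {a : ℂ} (h : x * y = y * x) {v : V}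
    (hv : x • v = a • v) : x • y • v = a • y • v := by
  rw [← mul_smul, h, mul_smul, hv, smul_algebra_smul_comm]

theorem exists_pow_smul_ne_zero_pow_succ_smul_eq_zero [FiniteDimensional ℂ V] {x y : Wq q}
    {μ a : ℂ} {v : V} (hμ0 : μ ≠ 0) (hμ : ∀ k : ℕ, 0 < k → μ ^ k ≠ 1)
    (h : x * y = μ • (y * x)) (hv : v ≠ 0) (hxv : x • v = a • v) (ha : a ≠ 0) :
    ∃ k : ℕ, y ^ k • v ≠ 0 ∧ y ^ (k + 1) • v = 0 := by
  have h1 := exists_pow_ne_zero_pow_succ_eq_zero (K := actL q V x) (E := actL q V y) hμ0 hμ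
    (by rw [← map_mul, h, map_smul, map_mul]) hv hxv ha
  simp only [← map_pow] at h1
  exact h1

/-- Raising operators shift weights by `q²` and lowering operators by `q⁻²`; the ladders terminate
because neither ratio is a root of unity. -/
theorem sq_pow_ne_one (hq : ∀ k : ℕ, 0 < k → q ^ k ≠ 1) (k : ℕ) (hk : 0 < k) :
    (q ^ 2) ^ k ≠ 1 := by
  rw [← pow_mul]; exact hq _ (by omega)

theorem inv_sq_pow_ne_one (hq : ∀ k : ℕ, 0 < k → q ^ k ≠ 1) (k : ℕ) (hk : 0 < k) :
    ((q ^ 2)⁻¹) ^ k ≠ 1 := by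
  rw [inv_pow, Ne, inv_eq_one]; exact sq_pow_ne_one hq k hk

/-- Every nonzero submodule of a finite-dimensional `W_q`-module contains a highest weight
vector. -/
theorem exists_isHighestWeight [FiniteDimensional ℂ V] (hq0 : q ≠ 0)
    (hq : ∀ k : ℕ, 0 < k → q ^ k ≠ 1) {W : Submodule (Wq q) V} (hW : W ≠ ⊥) :
    ∃ v ∈ W, ∃ a b c : ℂ, IsHighestWeight (q := q) v a b c := by
  have h0 : W.restrictScalars ℂ ≠ ⊥ := by
    rwa [Ne, Submodule.restrictScalars_eq_bot_iff]
  -- Each eigenspace is cut out inside the previous subspace, which remains stable under the next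
  -- operator because `I`, `K₂`, `K₁` commute.
  obtain ⟨c, hc⟩ := exists_eigenvector_mem (actL q V (Wq.gen q .I)) h0
    fun x hx => W.smul_mem _ hx
  obtain ⟨b, hb⟩ := exists_eigenvector_mem (actL q V (Wq.gen q .K2)) hc
    fun x hx => ⟨W.smul_mem _ hx.1, Module.End.mem_eigenspace_iff.2
      (smul_smul_of_comm (Wq.I_comm q _) (Module.End.mem_eigenspace_iff.1 hx.2))⟩
  obtain ⟨a, ha⟩ := exists_eigenvector_mem (actL q V (Wq.gen q .K1)) hb
    fun x hx => ⟨⟨W.smul_mem _ hx.1.1, Module.End.mem_eigenspace_iff.2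
      (smul_smul_of_comm (Wq.I_comm q _) (Module.End.mem_eigenspace_iff.1 hx.1.2))⟩,
      Module.End.mem_eigenspace_iff.2
      (smul_smul_of_comm (Wq.K1_K2 q).symm (Module.End.mem_eigenspace_iff.1 hx.2))⟩
  obtain ⟨v, ⟨⟨⟨hvW, hI⟩, hK2⟩, hK1⟩, hv0⟩ := Submodule.exists_mem_ne_zero_of_ne_bot ha
  replace hI : Wq.gen q .I • v = c • v := Module.End.mem_eigenspace_iff.1 hI
  replace hK1 : Wq.gen q .K1 • v = a • v := Module.End.mem_eigenspace_iff.1 hK1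
  replace hK2 : Wq.gen q .K2 • v = b • v := Module.End.mem_eigenspace_iff.1 hK2
  have hKE1 := (qBracket_eq_zero_iff_left hq0).1 (Wq.E1_K1 q)
  have hKE2 := (qBracket_eq_zero_iff_left hq0).1 (Wq.E2_K2 q)
  have hq2 := pow_ne_zero 2 hq0
  obtain ⟨k, hk, hk'⟩ := exists_pow_smul_ne_zero_pow_succ_smul_eq_zero hq2 (sq_pow_ne_one hq)
    hKE1 hv0 hK1 (eigenvalue_ne_zero (Wq.K1i_K1 q) hv0 hK1)
  -- `E₁^k v` is still a `K₂`-eigenvector, so it can serve as the start of the `E₂`-ladder.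
  have hK2' := smul_smul_of_comm ((Commute.pow_right (Wq.K2_E1 q) k)) hK2
  obtain ⟨l, hl, hl'⟩ := exists_pow_smul_ne_zero_pow_succ_smul_eq_zero hq2 (sq_pow_ne_one hq)
    hKE2 hk hK2' (eigenvalue_ne_zero (Wq.K2i_K2 q) hv0 hK2)
  refine ⟨_, W.smul_mem (Wq.gen q .E2 ^ l) (W.smul_mem (Wq.gen q .E1 ^ k) hvW), _, _, _,
    ⟨hl, ?_, ?_, smul_smul_of_comm (Commute.pow_right (Wq.K1_E2 q) l)
      (smul_pow_smul_of_qcomm hKE1 hK1 k), smul_pow_smul_of_qcomm hKE2 hK2' l,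
      smul_smul_of_comm (Wq.I_comm q _) (smul_smul_of_comm (Wq.I_comm q _) hI)⟩⟩
  -- `E₁` commutes past `E₂^l` and meets `E₁^k v`, which it kills.
  · rw [← mul_smul, (Commute.pow_right (Wq.E1_E2 q) l : _ * _ = _ * _), mul_smul, ← mul_smul _ _ v,
      ← pow_succ', hk', smul_zero]
  · rw [← mul_smul, ← pow_succ', hl']

end HighestWeight

/-! ### Irreducibility of `(L_m ⊗ L_n)^{δ,lam}` -/

section Simple

variable {q : ℂ} (hq0 : q ≠ 0) (p : Quad)

theorem Quad.δ_ne_zero : p.δ ≠ 0 := by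
  rcases p.hδ with h | h <;> rw [h] <;> norm_num

/-- No bounds on `i`, `j` are needed: out of range the vector is zero and the condition on `k` never
holds. -/
theorem LLbasis_repr_LLvec (i j : ℕ) (k : Fin (p.m + 1) × Fin (p.n + 1)) :
    (LLbasis hq0 p).repr (LLvec hq0 p i j) k = if (k.1 : ℕ) = i ∧ (k.2 : ℕ) = j then 1 else 0 := by
  by_cases hi : i ≤ p.m
  · by_cases hj : j ≤ p.n
    · have h : LLvec hq0 p i j =
          LLbasis hq0 p (⟨i, Nat.lt_succ_of_le hi⟩, ⟨j, Nat.lt_succ_of_le hj⟩) := by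
        rw [LLbasis_apply]
      rw [h, Module.Basis.repr_self, Finsupp.single_apply]
      congr 1
      simp [Prod.ext_iff, Fin.ext_iff, eq_comm]
    · rw [LLvec_eq_zero_right _ _ _ (not_le.1 hj), if_neg (by have := k.2.2; omega)]
      simp
  · rw [LLvec_eq_zero_left _ _ (not_le.1 hi), if_neg (by have := k.1.2; omega)]
    simp

/-- `E₁` lowers the first index by one, so only `v_(i+1) ⊗ v_j` contributes to coordinate `(i, j)`.
This turns `E₁ x = 0` into the vanishing of individual coordinates. -/
theorem LLbasis_repr_E1_smul (x : LL hq0 p) (i : ℕ) (hi : i + 1 < p.m + 1)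
    (j : Fin (p.n + 1)) :
    (LLbasis hq0 p).repr (Wq.gen q .E1 • x) (⟨i, by omega⟩, j) =
      (p.lam * (qInt q (i + 1) * qInt q (p.m - i))) *
        (LLbasis hq0 p).repr x (⟨i + 1, hi⟩, j) := by
  have : (LLbasis hq0 p).coord (⟨i, by omega⟩, j) ∘ₗ actL q _ (Wq.gen q .E1) =
      (p.lam * (qInt q (i + 1) * qInt q (p.m - i))) •
        (LLbasis hq0 p).coord (⟨i + 1, hi⟩, j) := by
    refine (LLbasis hq0 p).ext fun ⟨⟨k, hk⟩, l⟩ => ?_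
    simp only [LinearMap.comp_apply, Algebra.lsmul_coe, LLbasis_apply, LinearMap.smul_apply,
      Module.Basis.coord_apply, LLbasis_repr_LLvec]
    cases k with
    | zero => simp [E1_smul_LLvec_zero]
    | succ k =>
      rw [E1_smul_LLvec_succ _ _ (by omega), map_smul, Finsupp.smul_apply, LLbasis_repr_LLvec]
      by_cases h : i = k <;> simp [h]
  exact LinearMap.congr_fun this x

theorem LLbasis_repr_E2_smul (x : LL hq0 p) (i : Fin (p.m + 1)) (j : ℕ) (hj : j + 1 < p.n + 1) :
    (LLbasis hq0 p).repr (Wq.gen q .E2 • x) (i, ⟨j, by omega⟩) =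
      (p.δ * p.lam * (qInt q (j + 1) * qInt q (p.n - j))) *
        (LLbasis hq0 p).repr x (i, ⟨j + 1, hj⟩) := by
  have : (LLbasis hq0 p).coord (i, ⟨j, by omega⟩) ∘ₗ actL q _ (Wq.gen q .E2) =
      (p.δ * p.lam * (qInt q (j + 1) * qInt q (p.n - j))) •
        (LLbasis hq0 p).coord (i, ⟨j + 1, hj⟩) := by
    refine (LLbasis hq0 p).ext fun ⟨k, ⟨l, hl⟩⟩ => ?_
    simp only [LinearMap.comp_apply, Algebra.lsmul_coe, LLbasis_apply, LinearMap.smul_apply,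
      Module.Basis.coord_apply, LLbasis_repr_LLvec]
    cases l with
    | zero => simp [E2_smul_LLvec_zero]
    | succ l =>
      rw [E2_smul_LLvec_succ _ _ _ (by omega), map_smul, Finsupp.smul_apply, LLbasis_repr_LLvec]
      by_cases h : j = l <;> simp [h]
  exact LinearMap.congr_fun this x

/-- The coefficients `[i+1]_q [m-i]_q` with `i < m` are nonzero, so `E₁ x = 0` kills every
coordinate with positive first index. `E₂ x = 0` does the same for the second index. -/
theorem exists_eq_smul_LLvec_zero (hq : ∀ k : ℕ, 0 < k → q ^ k ≠ 1) {x : LL hq0 p}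
    (h1 : Wq.gen q .E1 • x = 0)
    (h2 : Wq.gen q .E2 • x = 0) : ∃ t : ℂ, x = t • LLvec hq0 p 0 0 := by
  refine ⟨(LLbasis hq0 p).repr x (0, 0), (LLbasis hq0 p).ext_elem fun ⟨⟨i, hi⟩, ⟨j, hj⟩⟩ => ?_⟩
  rw [map_smul, Finsupp.smul_apply, LLbasis_repr_LLvec]
  cases i with
  | succ i =>
    have h := LLbasis_repr_E1_smul hq0 p x i hi ⟨j, hj⟩
    rw [h1, map_zero, Finsupp.zero_apply, eq_comm, mul_eq_zero, or_iff_right] at h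
    · simp [h]
    · exact mul_ne_zero p.hlam (mul_ne_zero (qInt_ne_zero hq0 hq (by omega))
        (qInt_ne_zero hq0 hq (by omega)))
  | zero =>
    cases j with
    | succ j =>
      have h := LLbasis_repr_E2_smul hq0 p x ⟨0, hi⟩ j hj
      rw [h2, map_zero, Finsupp.zero_apply, eq_comm, mul_eq_zero, or_iff_right] at h
      · exact h.trans (by simp)
      · exact mul_ne_zero (mul_ne_zero p.δ_ne_zero p.hlam)
          (mul_ne_zero (qInt_ne_zero hq0 hq (by omega)) (qInt_ne_zero hq0 hq (by omega)))
    | zero => simp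

/-- A nonzero submodule contains a highest weight vector, which is a nonzero multiple of `v_0 ⊗
v_0`; from there `F₁` and `F₂` reach every basis vector. -/
theorem LL_isSimpleModule (hq : ∀ k : ℕ, 0 < k → q ^ k ≠ 1) :
    IsSimpleModule (Wq q) (LL hq0 p) := by
  rw [isSimpleModule_iff]
  refine { eq_bot_or_eq_top := fun N => or_iff_not_imp_left.2 fun hN => ?_ }
  obtain ⟨v, hvN, a, b, c, hv⟩ := exists_isHighestWeight hq0 hq hN
  obtain ⟨t, rfl⟩ := exists_eq_smul_LLvec_zero hq0 p hq hv.E1 hv.E2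
  have ht : t ≠ 0 := by
    rintro rfl
    exact hv.ne_zero (zero_smul _ _)
  have h00 : LLvec hq0 p 0 0 ∈ N := by
    simpa [smul_smul, ht] using N.smul_of_tower_mem t⁻¹ hvN
  have hi0 : ∀ i ≤ p.m, LLvec hq0 p i 0 ∈ N := by
    intro i hi
    induction i with
    | zero => exact h00
    | succ i ih =>
      rw [← F1_smul_LLvec hq0 p (by omega)]
      exact N.smul_mem _ (ih (by omega))
  have hij : ∀ i ≤ p.m, ∀ j ≤ p.n, LLvec hq0 p i j ∈ N := by
    intro i hi j hj
    induction j with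
    | zero => exact hi0 i hi
    | succ j ih =>
      rw [← F2_smul_LLvec hq0 p _ (by omega)]
      exact N.smul_mem _ (ih (by omega))
  refine (Submodule.restrictScalars_eq_top_iff ℂ _ _).1 (top_unique ?_)
  rw [← (LLbasis hq0 p).span_eq, Submodule.span_le]
  rintro _ ⟨k, rfl⟩
  rw [LLbasis_apply]
  exact hij _ (by omega) _ (by omega)

end Simple

/-! ### The submodule generated by a highest weight vector -/

/-- A linear map between modules over an algebra commuting with `x` commutes with a left inverse of `x`
that is also a right inverse on the source. -/
theorem map_smul_of_inverse {A U V : Type*} [Ring A] [AddCommGroup U] [Module ℂ U] [Module A U]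
    [AddCommGroup V] [Module ℂ V] [Module A V] (f : U →ₗ[ℂ] V) {x y : A}
    (hxy : x * y = 1) (hyx : y * x = 1)
    (h : ∀ u, f (x • u) = x • f u) (u : U) : f (y • u) = y • f u := by
  have h1 := h (y • u)
  rw [← mul_smul, hxy, one_smul] at h1
  rw [h1, ← mul_smul, hyx, one_smul]

section Ladder

variable {q : ℂ}

/-- The induction step of `raise_pow_succ_smul`: an identity of rational functions in `q` and `q ^
i`. If `q = q⁻¹`, both sides vanish because division by zero gives zero. -/
theorem qInt_step (hq0 : q ≠ 0) (i : ℕ) (a b : ℂ) :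
    qInt q (i + 1) * ((q - q⁻¹)⁻¹ * (a * (q ^ i)⁻¹ - b * q ^ i)) +
        (q - q⁻¹)⁻¹ * ((q ^ 2)⁻¹ ^ (i + 1) * a - (q ^ 2) ^ (i + 1) * b) =
      qInt q (i + 1 + 1) * ((q - q⁻¹)⁻¹ * (a * (q ^ (i + 1))⁻¹ - b * q ^ (i + 1))) := by
  simp only [qInt]
  by_cases h : q - q⁻¹ = 0
  · simp [h]
  have hi := pow_ne_zero i hq0
  have h3 : q ^ 2 - 1 ≠ 0 := by
    intro h3
    apply h
    field_simp
    linear_combination h3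
  simp only [neg_add, zpow_add₀ hq0, zpow_neg, zpow_one, zpow_natCast, ← pow_mul, inv_pow]
  have e : q ^ (2 * (i + 1)) = q ^ i * q ^ i * q ^ 2 := by ring
  rw [e, pow_succ q i]
  generalize q ^ i = x at *
  field_simp
  ring

variable {V : Type*} [AddCommGroup V] [Module ℂ V] [Module (Wq q) V] [IsScalarTower ℂ (Wq q) V]

/-- Moving `x` past one `y` at a time produces a sum of commutator terms with a closed form. The
hypothesis `hxy` covers both pairs: `(E₁, F₁)` with scalars `a`, `c a⁻¹`, and `(E₂, F₂)` with
scalars `c b`, `b⁻¹`. -/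
theorem raise_pow_succ_smul (hq0 : q ≠ 0) {x y : Wq q} {v : V} {a b : ℂ} (hx : x • v = 0)
    (hxy : ∀ i : ℕ, (x * y - y * x) • y ^ i • v =
      ((q - q⁻¹)⁻¹ * ((q ^ 2)⁻¹ ^ i * a - (q ^ 2) ^ i * b)) • y ^ i • v) (i : ℕ) :
    x • y ^ (i + 1) • v =
      (qInt q (i + 1) * ((q - q⁻¹)⁻¹ * (a * (q ^ i)⁻¹ - b * q ^ i))) • y ^ i • v := by
  have key : ∀ i : ℕ, x • y ^ (i + 1) • v = y • x • y ^ i • v +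
      ((q - q⁻¹)⁻¹ * ((q ^ 2)⁻¹ ^ i * a - (q ^ 2) ^ i * b)) • y ^ i • v := by
    intro i
    rw [← hxy, sub_smul, pow_succ', mul_smul, mul_smul, mul_smul, add_sub_cancel]
  induction i with
  | zero =>
    rw [key, pow_zero, one_smul, hx, smul_zero, zero_add]
    by_cases h : q - q⁻¹ = 0
    · simp [h]
    · congr 1
      simp [qInt, h]
  | succ i ih =>
    rw [key, ih, smul_algebra_smul_comm, ← mul_smul y, ← pow_succ', ← add_smul, Nat.cast_succ,
      qInt_step hq0]

/-- The relation between the weights of a highest weight vector whose ladder has finite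
length, and the action of the raising operator on the ladder. -/
theorem raise_pow_succ_smul_of_finite (hq0 : q ≠ 0) (hq : ∀ k : ℕ, 0 < k → q ^ k ≠ 1)
    {x y : Wq q} {v : V} {a b : ℂ} (hx : x • v = 0)
    (hxy : ∀ i : ℕ, (x * y - y * x) • y ^ i • v =
      ((q - q⁻¹)⁻¹ * ((q ^ 2)⁻¹ ^ i * a - (q ^ 2) ^ i * b)) • y ^ i • v) {m : ℕ}
    (hm : y ^ m • v ≠ 0) (hm' : y ^ (m + 1) • v = 0) :
    a = b * q ^ m * q ^ m ∧ ∀ i : ℕ, x • y ^ (i + 1) • v =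
      (b * q ^ m * (qInt q (i + 1) * qInt q (m - i))) • y ^ i • v := by
  -- At the top exponent the left side is zero while `y ^ m • v` and `[m+1]_q` are not, which leaves
  -- `a q^(-m) = b q^m`.
  have h := raise_pow_succ_smul hq0 hx hxy m
  have hqm := pow_ne_zero m hq0
  rw [hm', smul_zero, eq_comm, smul_eq_zero, or_iff_left hm, mul_eq_zero,
    or_iff_right (qInt_ne_zero hq0 hq (by omega)), mul_eq_zero,
    or_iff_right (inv_ne_zero (sub_inv_ne_zero hq0 hq)), sub_eq_zero] at h
  have hab : a = b * q ^ m * q ^ m := by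
    rw [← h, inv_mul_cancel_right₀ hqm]
  refine ⟨hab, fun i => ?_⟩
  rw [raise_pow_succ_smul hq0 hx hxy]
  congr 1
  rw [mul_left_comm (b * q ^ m)]
  congr 1
  -- After substituting `a = b q^(2m)`, the remaining factor is `b q^m [m-i]_q`.
  simp only [hab, qInt, neg_sub, zpow_sub₀ hq0, zpow_natCast]
  have hqi := pow_ne_zero i hq0
  field_simp

end Ladder

section LadderVectors

variable {q : ℂ} {V : Type*} [AddCommGroup V] [Module (Wq q) V]

/-- The vector `F₁^i F₂^j v`. -/
noncomputable def ladder (q : ℂ) {V : Type*} [AddCommGroup V] [Module (Wq q) V] (v : V)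
    (i j : ℕ) : V :=
  Wq.gen q .F1 ^ i • Wq.gen q .F2 ^ j • v

theorem ladder_eq_smul_F1 (v : V) (i j : ℕ) :
    ladder q v i j = Wq.gen q .F2 ^ j • Wq.gen q .F1 ^ i • v := by
  rw [ladder, ← mul_smul, ← mul_smul, (Commute.pow_pow (Wq.F1_F2 q) i j).eq]

theorem F1_smul_ladder (v : V) (i j : ℕ) :
    Wq.gen q .F1 • ladder q v i j = ladder q v (i + 1) j := by
  rw [ladder, ← mul_smul, ← pow_succ', ladder]

theorem F2_smul_ladder (v : V) (i j : ℕ) :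
    Wq.gen q .F2 • ladder q v i j = ladder q v i (j + 1) := by
  rw [ladder_eq_smul_F1, ← mul_smul, ← pow_succ', ladder_eq_smul_F1]

variable [Module ℂ V]

/-- The linear map from `(L_m ⊗ L_n)^{δ,lam}` sending `v_i ⊗ v_j` to `F₁^i F₂^j v`. -/
noncomputable def ladderMap (hq0 : q ≠ 0) (p : Quad) (v : V) : LL hq0 p →ₗ[ℂ] V :=
  (LLbasis hq0 p).constr ℂ fun k => ladder q v k.1 k.2

/-- The range includes `i = m + 1` and `j = n + 1`, where both sides vanish; this is what
compatibility with `F₁` and `F₂` needs at the ends of the ladders. -/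
theorem ladderMap_LLvec (hq0 : q ≠ 0) (p : Quad) (v : V)
    (h1 : Wq.gen q .F1 ^ (p.m + 1) • v = 0) (h2 : Wq.gen q .F2 ^ (p.n + 1) • v = 0) {i j : ℕ}
    (hi : i ≤ p.m + 1) (hj : j ≤ p.n + 1) :
    ladderMap hq0 p v (LLvec hq0 p i j) = ladder q v i j := by
  rcases hi.lt_or_eq with hi | rfl
  · rcases hj.lt_or_eq with hj | rfl
    · have h : LLvec hq0 p i j = LLbasis hq0 p (⟨i, hi⟩, ⟨j, hj⟩) := by rw [LLbasis_apply]
      rw [h, ladderMap, Module.Basis.constr_basis]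
    · rw [LLvec_eq_zero_right _ _ _ (Nat.lt_succ_self _), map_zero, ladder, h2, smul_zero]
  · rw [LLvec_eq_zero_left _ _ (Nat.lt_succ_self _), map_zero, ladder_eq_smul_F1, h1, smul_zero]

end LadderVectors

/-! ### Classification by highest weights -/

section Classification

variable {q : ℂ} {V : Type*} [AddCommGroup V] [Module ℂ V] [Module (Wq q) V]
  [IsScalarTower ℂ (Wq q) V]

namespace IsHighestWeight

variable {v : V} {a b c : ℂ}

theorem K1_smul_F1_pow (hv : IsHighestWeight (q := q) v a b c) (hq0 : q ≠ 0) (i : ℕ) :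
    Wq.gen q .K1 • Wq.gen q .F1 ^ i • v = ((q ^ 2)⁻¹ ^ i * a) • Wq.gen q .F1 ^ i • v :=
  smul_pow_smul_of_qcomm ((qBracket_eq_zero_iff_right hq0).1 (Wq.K1_F1 q)) hv.K1 i

theorem K2_smul_F2_pow (hv : IsHighestWeight (q := q) v a b c) (hq0 : q ≠ 0) (j : ℕ) :
    Wq.gen q .K2 • Wq.gen q .F2 ^ j • v = ((q ^ 2)⁻¹ ^ j * b) • Wq.gen q .F2 ^ j • v :=
  smul_pow_smul_of_qcomm ((qBracket_eq_zero_iff_right hq0).1 (Wq.K2_F2 q)) hv.K2 j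

/-- On `F₁^i v` the element `K₁` acts by `q^(-2i) a`, its inverse by the reciprocal, and the central
`I` by `c`. The result has the form required by `raise_pow_succ_smul`. -/
theorem E1_F1_smul (hv : IsHighestWeight (q := q) v a b c) (hq0 : q ≠ 0) (i : ℕ) :
    (Wq.gen q .E1 * Wq.gen q .F1 - Wq.gen q .F1 * Wq.gen q .E1) • Wq.gen q .F1 ^ i • v =
      ((q - q⁻¹)⁻¹ * ((q ^ 2)⁻¹ ^ i * a - (q ^ 2) ^ i * (c * a⁻¹))) •
        Wq.gen q .F1 ^ i • v := by
  have hK := hv.K1_smul_F1_pow hq0 i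
  have hKi := smul_eq_inv_smul (Wq.K1i_K1 q) (mul_ne_zero
    (pow_ne_zero _ (inv_ne_zero (pow_ne_zero 2 hq0))) hv.a_ne_zero) hK
  rw [Wq.E1_F1, smul_assoc, sub_smul, mul_smul, hKi, hK, smul_algebra_smul_comm,
    smul_smul_of_comm (Wq.I_comm q _) hv.I, smul_smul, ← sub_smul, smul_smul]
  congr 3
  rw [mul_inv, inv_pow, inv_inv]
  ring

theorem E2_F2_smul (hv : IsHighestWeight (q := q) v a b c) (hq0 : q ≠ 0) (j : ℕ) :
    (Wq.gen q .E2 * Wq.gen q .F2 - Wq.gen q .F2 * Wq.gen q .E2) • Wq.gen q .F2 ^ j • v =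
      ((q - q⁻¹)⁻¹ * ((q ^ 2)⁻¹ ^ j * (c * b) - (q ^ 2) ^ j * b⁻¹)) •
        Wq.gen q .F2 ^ j • v := by
  have hK := hv.K2_smul_F2_pow hq0 j
  have hKi := smul_eq_inv_smul (Wq.K2i_K2 q) (mul_ne_zero
    (pow_ne_zero _ (inv_ne_zero (pow_ne_zero 2 hq0))) hv.b_ne_zero) hK
  rw [Wq.E2_F2, smul_assoc, sub_smul, mul_smul, hKi, hK, smul_algebra_smul_comm,
    smul_smul_of_comm (Wq.I_comm q _) hv.I, smul_smul, ← sub_smul, smul_smul]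
  congr 3
  · ring
  · rw [mul_inv, inv_pow, inv_inv]

end IsHighestWeight

/-- It suffices to compare both actions of each generator on the basis `v_i ⊗ v_j`. `I`, `K₁`, `K₂`
are treated beforehand, since their inverses then follow formally. -/
theorem ladderMap_smul (hq0 : q ≠ 0) (hq : ∀ k : ℕ, 0 < k → q ^ k ≠ 1) (p : Quad) {v : V}
    (hv : IsHighestWeight (q := q) v (p.lam * q ^ p.m) (p.δ * p.lam⁻¹ * q ^ p.n) (p.lam ^ 2))
    (h1 : Wq.gen q .F1 ^ p.m • v ≠ 0) (h1' : Wq.gen q .F1 ^ (p.m + 1) • v = 0)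
    (h2 : Wq.gen q .F2 ^ p.n • v ≠ 0) (h2' : Wq.gen q .F2 ^ (p.n + 1) • v = 0)
    (x : Wq q) (u : LL hq0 p) : ladderMap hq0 p v (x • u) = x • ladderMap hq0 p v u := by
  have hδ2 : p.δ * p.δ = 1 := by rcases p.hδ with h | h <;> rw [h] <;> norm_num
  have hδi : p.δ⁻¹ = p.δ := inv_eq_of_mul_eq_one_right hδ2
  have hl := p.hlam
  have hδ := p.δ_ne_zero
  have basis : ∀ x : Wq q, (∀ i ≤ p.m, ∀ j ≤ p.n,
      ladderMap hq0 p v (x • LLvec hq0 p i j) = x • ladder q v i j) →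
      ∀ u : LL hq0 p, ladderMap hq0 p v (x • u) = x • ladderMap hq0 p v u := by
    intro x hx u
    have : ladderMap hq0 p v ∘ₗ actL q _ x = actL q _ x ∘ₗ ladderMap hq0 p v := by
      refine (LLbasis hq0 p).ext fun k => ?_
      simp only [LinearMap.comp_apply, Algebra.lsmul_coe, LLbasis_apply]
      rw [hx _ (by omega) _ (by omega), ladderMap_LLvec hq0 p v h1' h2' (by omega) (by omega)]
    exact LinearMap.congr_fun this u
  have map := fun {i j : ℕ} (hi : i ≤ p.m + 1) (hj : j ≤ p.n + 1) =>
    ladderMap_LLvec hq0 p v h1' h2' hi hj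
  have hI : ∀ u : LL hq0 p, ladderMap hq0 p v (Wq.gen q .I • u) =
      Wq.gen q .I • ladderMap hq0 p v u := by
    refine basis _ fun i hi j hj => ?_
    rw [I_smul, map_smul, map (by omega) (by omega), ladder,
      smul_smul_of_comm (Wq.I_comm q _) (smul_smul_of_comm (Wq.I_comm q _) hv.I)]
  have hK1 : ∀ u : LL hq0 p, ladderMap hq0 p v (Wq.gen q .K1 • u) =
      Wq.gen q .K1 • ladderMap hq0 p v u := by
    refine basis _ fun i hi j hj => ?_
    rw [K1_smul_LLvec _ _ hi, map_smul, map (by omega) (by omega), ladder_eq_smul_F1,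
      smul_smul_of_comm (Commute.pow_right (Wq.K1_F2 q) j) (hv.K1_smul_F1_pow hq0 i),
      zpow_sub₀ hq0, zpow_mul, inv_pow]
    congr 1
    norm_cast
    ring
  have hK2 : ∀ u : LL hq0 p, ladderMap hq0 p v (Wq.gen q .K2 • u) =
      Wq.gen q .K2 • ladderMap hq0 p v u := by
    refine basis _ fun i hi j hj => ?_
    rw [K2_smul_LLvec _ _ _ hj, map_smul, map (by omega) (by omega), ladder,
      smul_smul_of_comm (Commute.pow_right (Wq.K2_F1 q) i) (hv.K2_smul_F2_pow hq0 j),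
      zpow_sub₀ hq0, zpow_mul, inv_pow]
    congr 1
    norm_cast
    ring
  induction x using Wq.induction_on generalizing u with
  | halg c => rw [algebraMap_smul, algebraMap_smul, map_smul]
  | hmul x y hx hy => rw [mul_smul, hx, hy, mul_smul]
  | hadd x y hx hy => rw [add_smul, map_add, hx, hy, add_smul]
  | hgen x =>
    cases x with
    | I => exact hI u
    | Ii => exact map_smul_of_inverse _ (Wq.I_Ii q) (Wq.Ii_I q) hI u
    | K1 => exact hK1 u
    | K1i => exact map_smul_of_inverse _ (Wq.K1_K1i q) (Wq.K1i_K1 q) hK1 u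
    | K2 => exact hK2 u
    | K2i => exact map_smul_of_inverse _ (Wq.K2_K2i q) (Wq.K2i_K2 q) hK2 u
    | F1 =>
      refine basis _ (fun i hi j hj => ?_) u
      rw [F1_smul_LLvec _ _ hi, map (by omega) (by omega), F1_smul_ladder]
    | F2 =>
      refine basis _ (fun i hi j hj => ?_) u
      rw [F2_smul_LLvec _ _ _ hj, map (by omega) (by omega), F2_smul_ladder]
    | E1 =>
      refine basis _ (fun i hi j hj => ?_) u
      rw [ladder_eq_smul_F1, ← mul_smul, (Commute.pow_right (Wq.E1_F2 q) j).eq, mul_smul]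
      cases i with
      | zero => rw [E1_smul_LLvec_zero, map_zero, pow_zero, one_smul, hv.E1, smul_zero]
      | succ i =>
        -- The ladder scalar `c a⁻¹ q^m`, with `c = λ²` and `a = λ q^m`, equals the factor `λ` by
        -- which the twist scales `E₁`.
        have e : p.lam ^ 2 * (p.lam * q ^ p.m)⁻¹ * q ^ p.m = p.lam := by
          have := pow_ne_zero p.m hq0
          field_simp
        rw [E1_smul_LLvec_succ _ _ hi, map_smul, map (by omega) (by omega),
          (raise_pow_succ_smul_of_finite hq0 hq hv.E1 (hv.E1_F1_smul hq0) h1 h1').2 i,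
          smul_algebra_smul_comm, ← ladder_eq_smul_F1, e]
    | E2 =>
      refine basis _ (fun i hi j hj => ?_) u
      rw [ladder, ← mul_smul, (Commute.pow_right (Wq.F1_E2 q).symm i).eq, mul_smul]
      cases j with
      | zero => rw [E2_smul_LLvec_zero, map_zero, pow_zero, one_smul, hv.E2, smul_zero]
      | succ j =>
        -- Here the ladder scalar is `b⁻¹ q^n`, which equals the twist factor `δ λ` because `δ⁻¹ =
        -- δ`.
        have e : (p.δ * p.lam⁻¹ * q ^ p.n)⁻¹ * q ^ p.n = p.δ * p.lam := by
          have := pow_ne_zero p.n hq0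
          rw [mul_inv, mul_inv, hδi, inv_inv, inv_mul_cancel_right₀ this]
        rw [E2_smul_LLvec_succ _ _ _ hj, map_smul, map (by omega) (by omega),
          (raise_pow_succ_smul_of_finite hq0 hq hv.E2 (hv.E2_F2_smul hq0) h2 h2').2 j,
          smul_algebra_smul_comm, ← ladder, e]

/-- The highest weights of a finite-dimensional `W_q`-module are those of the modules
`(L_m ⊗ L_n)^{δ,lam}`. -/
theorem IsHighestWeight.exists_quad [FiniteDimensional ℂ V] (hq0 : q ≠ 0)
    (hq : ∀ k : ℕ, 0 < k → q ^ k ≠ 1) {v : V} {a b c : ℂ}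
    (hv : IsHighestWeight (q := q) v a b c) :
    ∃ p : Quad, IsHighestWeight (q := q) v (p.lam * q ^ p.m) (p.δ * p.lam⁻¹ * q ^ p.n)
        (p.lam ^ 2) ∧
      Wq.gen q .F1 ^ p.m • v ≠ 0 ∧ Wq.gen q .F1 ^ (p.m + 1) • v = 0 ∧
      Wq.gen q .F2 ^ p.n • v ≠ 0 ∧ Wq.gen q .F2 ^ (p.n + 1) • v = 0 := by
  have hq2 := inv_ne_zero (pow_ne_zero 2 hq0)
  obtain ⟨m, hm, hm'⟩ := exists_pow_smul_ne_zero_pow_succ_smul_eq_zero hq2 (inv_sq_pow_ne_one hq)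
    ((qBracket_eq_zero_iff_right hq0).1 (Wq.K1_F1 q)) hv.ne_zero hv.K1 hv.a_ne_zero
  obtain ⟨n, hn, hn'⟩ := exists_pow_smul_ne_zero_pow_succ_smul_eq_zero hq2 (inv_sq_pow_ne_one hq)
    ((qBracket_eq_zero_iff_right hq0).1 (Wq.K2_F2 q)) hv.ne_zero hv.K2 hv.b_ne_zero
  have h1 := (raise_pow_succ_smul_of_finite hq0 hq hv.E1 (hv.E1_F1_smul hq0) hm hm').1
  have h2 := (raise_pow_succ_smul_of_finite hq0 hq hv.E2 (hv.E2_F2_smul hq0) hn hn').1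
  have ha := hv.a_ne_zero
  have hb := hv.b_ne_zero
  have hqm := pow_ne_zero m hq0
  have hqn := pow_ne_zero n hq0
  -- The weights `a = λ q^m` and `b = δ λ⁻¹ q^n` force `λ = a q^(-m)` and `δ = b q^(-n) λ`. By `h1`,
  -- `λ² = c`; then `h2`, which reads `c b = b⁻¹ q^(2n)`, gives `δ² = 1`.
  have hl : a * (q ^ m)⁻¹ ≠ 0 := mul_ne_zero ha (inv_ne_zero hqm)
  have hlsq : (a * (q ^ m)⁻¹) ^ 2 = c := by
    field_simp at h1 ⊢
    linear_combination h1
  have ht : (b * (q ^ n)⁻¹ * (a * (q ^ m)⁻¹)) ^ 2 = 1 := by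
    rw [mul_pow, hlsq]
    field_simp at h2 ⊢
    linear_combination h2
  refine ⟨⟨m, n, b * (q ^ n)⁻¹ * (a * (q ^ m)⁻¹), a * (q ^ m)⁻¹,
    mul_self_eq_one_iff.1 ((pow_two _).symm.trans ht),
    hl⟩, ?_, hm, hm', hn, hn'⟩
  have e1 : a * (q ^ m)⁻¹ * q ^ m = a := inv_mul_cancel_right₀ hqm a
  have e2 : b * (q ^ n)⁻¹ * (a * (q ^ m)⁻¹) * (a * (q ^ m)⁻¹)⁻¹ * q ^ n = b := by
    rw [mul_inv_cancel_right₀ hl, inv_mul_cancel_right₀ hqn]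
  simp only [e1, e2, hlsq]
  exact hv

theorem exists_quad_equiv [FiniteDimensional ℂ V] [IsSimpleModule (Wq q) V] (hq0 : q ≠ 0)
    (hq : ∀ k : ℕ, 0 < k → q ^ k ≠ 1) : ∃ p : Quad, Nonempty (LL hq0 p ≃ₗ[Wq q] V) := by
  have : Nontrivial V := IsSimpleModule.nontrivial (Wq q) V
  obtain ⟨v, -, a, b, c, hv⟩ :=
    exists_isHighestWeight hq0 hq (top_ne_bot : (⊤ : Submodule (Wq q) V) ≠ ⊥)
  obtain ⟨p, hp, h1, h1', h2, h2'⟩ := hv.exists_quad hq0 hq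
  have := LL_isSimpleModule hq0 p hq
  let f : LL hq0 p →ₗ[Wq q] V :=
    { toFun := ladderMap hq0 p v
      map_add' := map_add _
      map_smul' := ladderMap_smul hq0 hq p hp h1 h1' h2 h2' }
  -- `f` sends `v_0 ⊗ v_0` to `v`, and a nonzero map between simple modules is bijective.
  have hf : f ≠ 0 := by
    intro h
    have h3 : ladderMap hq0 p v (LLvec hq0 p 0 0) = 0 := LinearMap.congr_fun h _
    rw [ladderMap_LLvec hq0 p v h1' h2' (Nat.zero_le _) (Nat.zero_le _), ladder, pow_zero,
      pow_zero, one_smul, one_smul] at h3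
    exact hv.ne_zero h3
  exact ⟨p, ⟨LinearEquiv.ofBijective f (LinearMap.bijective_of_ne_zero hf)⟩⟩

/-- The image of `v_0 ⊗ v_0` is killed by `E₁` and `E₂`, hence is a multiple of the other `v_0 ⊗
v_0`, so the eigenvalues of `I`, `K₁`, `K₂` on the two vectors agree. -/
theorem quad_eq_of_equiv (hq0 : q ≠ 0) (hq : ∀ k : ℕ, 0 < k → q ^ k ≠ 1) {p p' : Quad}
    (e : LL hq0 p ≃ₗ[Wq q] LL hq0 p') : p = p' := by
  obtain ⟨t, ht⟩ := exists_eq_smul_LLvec_zero hq0 p' hq (x := e (LLvec hq0 p 0 0))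
    (by rw [← map_smul, E1_smul_LLvec_zero, map_zero])
    (by rw [← map_smul, E2_smul_LLvec_zero, map_zero])
  have hx : e (LLvec hq0 p 0 0) ≠ 0 := by
    rw [Ne, LinearEquiv.map_eq_zero_iff]
    exact LLvec_zero_ne_zero hq0 p
  have eig : ∀ {g : WGen} {α β : ℂ}, Wq.gen q g • LLvec hq0 p 0 0 = α • LLvec hq0 p 0 0 →
      Wq.gen q g • LLvec hq0 p' 0 0 = β • LLvec hq0 p' 0 0 → α = β := by
    intro g α β h1 h2
    refine smul_left_injective ℂ hx ?_
    change α • e _ = β • e _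
    rw [← algebraMap_smul (Wq q) α (e _), ← map_smul, algebraMap_smul, ← h1, map_smul, ht,
      smul_algebra_smul_comm, h2, smul_comm]
  have hI := eig (I_smul hq0 p _) (I_smul hq0 p' _)
  have hK1 := eig (K1_smul_LLvec hq0 p (Nat.zero_le _) 0) (K1_smul_LLvec hq0 p' (Nat.zero_le _) 0)
  have hK2 := eig (K2_smul_LLvec hq0 p 0 (Nat.zero_le _)) (K2_smul_LLvec hq0 p' 0 (Nat.zero_le _))
  simp only [Nat.cast_zero, mul_zero, sub_zero, zpow_natCast] at hK1 hK2
  -- `I` determines `λ` only up to sign, so `m` is read off from `(λ q^m)² / λ² = q^(2m)`; then `K₁`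
  -- gives `λ` itself.
  have inj : ∀ {k l : ℕ}, (q ^ k) ^ 2 = (q ^ l) ^ 2 → k = l := by
    intro k l h
    rw [← pow_mul, ← pow_mul, ← zpow_natCast, ← zpow_natCast] at h
    have := zpow_injective_of_not_root hq0 hq h
    omega
  have hm : p.m = p'.m := inj <| mul_left_cancel₀ (pow_ne_zero 2 p.hlam) <| by
    rw [← mul_pow, hK1, mul_pow, hI]
  rw [hm] at hK1
  have hlam : p.lam = p'.lam := mul_right_cancel₀ (pow_ne_zero _ hq0) hK1
  have hsq : ∀ p : Quad, p.δ ^ 2 = 1 := by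
    intro p
    rcases p.hδ with h | h <;> rw [h] <;> norm_num
  have hli := inv_ne_zero p'.hlam
  -- Squaring the `K₂`-eigenvalue removes `δ`, which is recovered only once `n` is known.
  have hn : p.n = p'.n := inj <| mul_left_cancel₀ (pow_ne_zero 2 hli) <| by
    have := congrArg (· ^ 2) hK2
    simpa only [mul_pow, hsq, one_mul, hlam] using this
  rw [hn, hlam] at hK2
  have hδ : p.δ = p'.δ :=
    mul_right_cancel₀ hli (mul_right_cancel₀ (pow_ne_zero _ hq0) hK2)
  cases p
  cases p'
  simp only at hm hn hδ hlam
  subst hm hn hδ hlam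
  rfl

end Classification

/-! ### Isomorphism classes -/

theorem modClass_eq_iff {q : ℂ} {V W : Type u} [AddCommGroup V] [Module (Wq q) V]
    [AddCommGroup W] [Module (Wq q) W] :
    modClass q V = modClass q W ↔ Nonempty (V ≃ₗ[Wq q] W) := by
  refine Quotient.eq.trans ⟨fun ⟨i⟩ => ⟨i.toLinearEquiv⟩, fun ⟨e⟩ => ⟨e.toModuleIso⟩⟩

end QuantumCovering

theorem mainTheorem8 (q : ℂ) (hq0 : q ≠ 0) (hq : ∀ k : ℕ, 0 < k → q ^ k ≠ 1) :
    (∀ (V : Type u) [AddCommGroup V] [Module ℂ V] [Module (QuantumCovering.Wq q) V]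
        [IsScalarTower ℂ (QuantumCovering.Wq q) V],
        FiniteDimensional ℂ V → IsSimpleModule (QuantumCovering.Wq q) V →
        ∃! p : QuantumCovering.Quad,
          Nonempty (QuantumCovering.LL hq0 p ≃ₗ[QuantumCovering.Wq q] V)) ∧
      Set.BijOn (QuantumCovering.quadClass.{u} hq0) Set.univ
        (QuantumCovering.finDimIrrClasses.{u} q) := by
  open QuantumCovering in
  -- The four goals are unique existence of the quadruple, and that the class map lands in the
  -- target, is injective and is surjective.
  refine ⟨fun V _ _ _ _ _ _ => ?_, fun p _ => ?_, fun p _ p' _ h => ?_, ?_⟩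
  · obtain ⟨p, ⟨e⟩⟩ := exists_quad_equiv (V := V) hq0 hq
    exact ⟨p, ⟨e⟩, fun p' ⟨e'⟩ => quad_eq_of_equiv hq0 hq (e'.trans e.symm)⟩
  · have := LL_isSimpleModule hq0 p hq
    exact ⟨ULift.{u} (LL hq0 p), inferInstance, inferInstance, inferInstance,
      inferInstance, inferInstance, IsSimpleModule.congr ULift.moduleEquiv, rfl⟩
  · obtain ⟨e⟩ := modClass_eq_iff.1 h
    exact quad_eq_of_equiv hq0 hq
      ((ULift.moduleEquiv.symm.trans e).trans ULift.moduleEquiv)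
  · rintro _ ⟨V, _, _, _, _, _, _, rfl⟩
    obtain ⟨p, ⟨e⟩⟩ := exists_quad_equiv (V := V) hq0 hq
    exact ⟨p, Set.mem_univ p, modClass_eq_iff.2 ⟨ULift.moduleEquiv.trans e⟩⟩
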